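/- Let $q$ be a complex number with $0<|q|<1$ and let $\omega$ be a primitive cube root of unity. Write $(a;q)_n=\prod_{i=0}^{n-1}(1-aq^i)$, $(a;q)_\infty=\prod_{i=0}^{\infty}(1-aq^i)$, $(a_1,\dots,a_m;q)_\infty=(a_1;q)_\infty\cdots(a_m;q)_\infty$, and $${}_2\phi_1\left(\begin{matrix}a,b\\c\end{matrix};q,z\right)=\sum_{n=0}^\infty\frac{(a;q)_n(b;q)_n}{(q;q)_n(c;q)_n}\,z^n .$$ (i) For every choice of the square root $q^{1/2}$, with $q^{m/2}=(q^{1/2})^m$, the following triple series converges absolutely and $$\sum_{i,j,k=0}^{\infty}\frac{(-1)^{j+k}q^{2\binom{i+j+3k}{2}+6\binom k2+2i+\frac 32j+9k}}{(q;q)_i(-q;-q)_{j}(q^6;q^6)_k}=\frac{1}{(-q^{3/2},q^{5/2};-q^3)_\infty(q^4;q^6)_\infty(q^2;q^{12})_\infty}.$$ (ii) For every choice of the fourth root $q^{1/4}$, with $q^{m/4}=(q^{1/4})^m$, the following series converges and $${}_2\phi_1\left(\begin{matrix}q^{1/4}\omega,-q^{3/4}\omega\\-q\end{matrix};q,q^{1/2}\omega^2\right)=\frac{(q^3;q^6)_\infty}{(q^{1/2}\omega^2;q)_\infty(-q^{3/4},q^{5/4};-q^{3/2})_\infty(q^2;q^6)_\infty}.$$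 (iii) The identities (i) and (ii) (the latter with $q$ replaced by $q^2$) are equivalent through the relation, valid for every choice of $q^{1/2}$, $$\sum_{i,j,k=0}^{\infty}\frac{(-1)^{j+k}q^{2\binom{i+j+3k}{2}+6\binom k2+2i+\frac 32j+9k}}{(q;q)_i(-q;-q)_{j}(q^6;q^6)_k}=(-q^2,q\omega^2;q^2)_\infty\,{}_2\phi_1\left(\begin{matrix}q^{1/2}\omega,-q^{3/2}\omega\\-q^2\end{matrix};q^2,q\omega^2\right),$$ in which the ${}_2\phi_1$ series converges. -/

import Mathlib

/-- The finite `q`-shifted factorial `(a;q)_n = ∏_{i=0}^{n-1} (1 - a q^i)`. -/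
noncomputable def qPoch (a q : ℂ) (n : ℕ) : ℂ :=
  ∏ i ∈ Finset.range n, (1 - a * q ^ i)

/-- The infinite `q`-shifted factorial `(a;q)_∞ = ∏_{i=0}^∞ (1 - a q^i)`. -/
noncomputable def qPochInf (a q : ℂ) : ℂ :=
  ∏' i : ℕ, (1 - a * q ^ i)

/-- For `|q| < 1` the product defining `(a;q)_∞` converges unconditionally. -/
theorem multipliable_qPochInf (a : ℂ) {q : ℂ} (hq : ‖q‖ < 1) :
    Multipliable fun i : ℕ => 1 - a * q ^ i := by
  have h : Summable fun i : ℕ => ‖-(a * q ^ i)‖ := by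
    simpa [norm_mul, norm_pow] using
      (summable_geometric_of_lt_one (norm_nonneg q) hq).mul_left ‖a‖
  simpa [sub_eq_add_neg] using multipliable_one_add_of_summable h

/-- The `n`-th term of the basic hypergeometric series `₂φ₁(a, b; c; q, z)`, namely
`(a;q)_n (b;q)_n / ((q;q)_n (c;q)_n) * z^n`. -/
noncomputable def twoPhiOneTerm (a b c q z : ℂ) (n : ℕ) : ℂ :=
  qPoch a q n * qPoch b q n / (qPoch q q n * qPoch c q n) * z ^ n

/-- The basic hypergeometric series `₂φ₁(a, b; c; q, z)`. -/
noncomputable def twoPhiOne (a b c q z : ℂ) : ℂ :=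
  ∑' n : ℕ, twoPhiOneTerm a b c q z n

/-- The `(i, j, k)` term of the triple series, where `s` is a square root of `q`,
so that `s ^ (3 * j)` is `q^{(3/2) j}`. -/
noncomputable def tripleTerm (q s : ℂ) (i j k : ℕ) : ℂ :=
  (-1) ^ (j + k) *
      (q ^ (2 * (i + j + 3 * k).choose 2 + 6 * k.choose 2 + 2 * i + 9 * k) * s ^ (3 * j)) /
    (qPoch q q i * qPoch (-q) (-q) j * qPoch (q ^ 6) (q ^ 6) k)

/-!
The work is done in terms of `s = q^{1/2}` for the triple sum and `s = q^{1/4}` for the `₂φ₁`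
series, so that in both cases the `₂φ₁` series has base `p = s⁴`.

*The summation of the `₂φ₁` series.* With `t = -s²` and `a = sω`, the numerator factors combine to
`(a; t)_{2n}` and the denominator factors to `(t⁴; t⁴)_n`. Expanding infinite products by the
`q`-binomial theorem and interchanging the sums (`tsum_mul_qPochInf_div`) turns the series into a
`₃φ₂` series in base `t` (`tsum_qPoch_two_mul_eq`). A transformation of `₃φ₂` series, which is a
double application of the same interchange around Euler's transformation of `₂φ₁`
(`tsum_twoPhiOneTerm_mul`), leads to the series
`∑ (-s, -sω, -sω²; t)_n / (t, tω, tω²; t)_n (-s)^n`. Because `ω` is a primitive cube root of unity,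
this is `∑ (-s³; t³)_n / (t³; t³)_n (-s)^n`, which the `q`-binomial theorem in base `t³` sums
(`twoPhiOne_eq_base_neg_sq`). The products are then rearranged to the stated form (`twoPhiOne_eq`).

*The relation with the triple sum.* With `n = i + j + 3k` the triple sum is
`∑ p^{n(n-1)/2} c_n`, where `c_n` is generated by
`(s¹⁸X³; s¹²)_∞ / ((s⁴X; s²)_∞ (-s³X; -s²)_∞)`. This formal series factors as `1 / (pX; p)_∞` times
a generating function of Al-Salam–Chihara polynomials (`qExp_mul_qExp_mul_expand`), whose
coefficients are, up to elementary factors, those of `(z; p)_∞ ₂φ₁(sω, -s³ω; -s⁴; p, z)`. Summing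
over the index of the first factor gives the relation (`tsum_tripleTerm_eq_twoPhiOne`). Identities
between formal power series, like Euler's transformation, are proved by checking that both sides
solve the same `q`-difference equation, in which `X ↦ pX` is `PowerSeries.rescale p`.
-/

open Filter Topology

/-! ### Finite and infinite `q`-shifted factorials -/

@[simp] theorem qPoch_zero (a q : ℂ) : qPoch a q 0 = 1 := by simp [qPoch]

theorem qPoch_succ (a q : ℂ) (n : ℕ) : qPoch a q (n + 1) = qPoch a q n * (1 - a * q ^ n) := by
  simp [qPoch, Finset.prod_range_succ]

@[simp] theorem qPoch_zero_left (q : ℂ) (n : ℕ) : qPoch 0 q n = 1 := by simp [qPoch]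

@[simp] theorem qPochInf_zero_left (q : ℂ) : qPochInf 0 q = 1 := by simp [qPochInf]

theorem qPoch_tendsto (a : ℂ) {q : ℂ} (hq : ‖q‖ < 1) :
    Tendsto (qPoch a q) atTop (𝓝 (qPochInf a q)) :=
  (multipliable_qPochInf a hq).hasProd.tendsto_prod_nat

theorem qPochInf_eq_qPoch_mul (a : ℂ) {q : ℂ} (hq : ‖q‖ < 1) (n : ℕ) :
    qPochInf a q = qPoch a q n * qPochInf (a * q ^ n) q := by
  have h : Tendsto (fun N => qPoch a q n * qPoch (a * q ^ n) q N) atTop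
      (𝓝 (qPoch a q n * qPochInf (a * q ^ n) q)) :=
    (qPoch_tendsto (a * q ^ n) hq).const_mul _
  refine tendsto_nhds_unique (((tendsto_add_atTop_iff_nat n).2 (qPoch_tendsto a hq))) (h.congr ?_)
  intro N
  simp only [qPoch]
  rw [add_comm, Finset.prod_range_add]
  simp [pow_add, mul_assoc]

theorem one_sub_ne_zero_of_norm_lt_one {x : ℂ} (hx : ‖x‖ < 1) : 1 - x ≠ 0 := by
  intro h
  rw [← sub_eq_zero.1 h] at hx
  simp at hx

theorem norm_mul_pow_lt_one {a q : ℂ} (ha : ‖a‖ < 1) (hq : ‖q‖ < 1) (n : ℕ) :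
    ‖a * q ^ n‖ < 1 := by
  rw [norm_mul, norm_pow]
  exact (mul_le_of_le_one_right (norm_nonneg _) (pow_le_one₀ (norm_nonneg _) hq.le)).trans_lt ha

theorem qPoch_ne_zero {a q : ℂ} (ha : ‖a‖ < 1) (hq : ‖q‖ < 1) (n : ℕ) : qPoch a q n ≠ 0 :=
  Finset.prod_ne_zero_iff.2 fun i _ =>
    one_sub_ne_zero_of_norm_lt_one (norm_mul_pow_lt_one ha hq i)

theorem qPochInf_ne_zero {a q : ℂ} (ha : ‖a‖ < 1) (hq : ‖q‖ < 1) : qPochInf a q ≠ 0 := by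
  have := tprod_one_add_ne_zero_of_summable (f := fun i : ℕ => -(a * q ^ i))
    (fun i => by
      simpa [sub_eq_add_neg] using one_sub_ne_zero_of_norm_lt_one (norm_mul_pow_lt_one ha hq i))
    (by
      simpa [norm_mul, norm_pow] using
        (summable_geometric_of_lt_one (norm_nonneg q) hq).mul_left ‖a‖)
  simpa [qPochInf, sub_eq_add_neg] using this

theorem qPoch_eq_div {a q : ℂ} (ha : ‖a‖ < 1) (hq : ‖q‖ < 1) (n : ℕ) :
    qPoch a q n = qPochInf a q / qPochInf (a * q ^ n) q := by
  rw [eq_div_iff (qPochInf_ne_zero (norm_mul_pow_lt_one ha hq n) hq),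
    ← qPochInf_eq_qPoch_mul a hq n]

theorem qPochInf_mul_pow {a q : ℂ} (ha : ‖a‖ < 1) (hq : ‖q‖ < 1) (n : ℕ) :
    qPochInf (a * q ^ n) q = qPochInf a q / qPoch a q n := by
  rw [eq_div_iff (qPoch_ne_zero ha hq n), mul_comm, ← qPochInf_eq_qPoch_mul a hq n]

theorem qPoch_two_mul (a q : ℂ) (n : ℕ) :
    qPoch a q (2 * n) = qPoch a (q ^ 2) n * qPoch (a * q) (q ^ 2) n := by
  induction n with
  | zero => simp
  | succ n ih =>
    rw [show 2 * (n + 1) = 2 * n + 1 + 1 by ring, qPoch_succ, qPoch_succ, ih, qPoch_succ,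
      qPoch_succ]
    ring

theorem qPoch_three_mul (a q : ℂ) (n : ℕ) : qPoch a q (3 * n) =
    qPoch a (q ^ 3) n * qPoch (a * q) (q ^ 3) n * qPoch (a * q ^ 2) (q ^ 3) n := by
  induction n with
  | zero => simp
  | succ n ih =>
    rw [show 3 * (n + 1) = 3 * n + 1 + 1 + 1 by ring, qPoch_succ, qPoch_succ, qPoch_succ, ih,
      qPoch_succ, qPoch_succ, qPoch_succ]
    ring

theorem norm_pow_lt_one {q : ℂ} (hq : ‖q‖ < 1) {n : ℕ} (hn : n ≠ 0) : ‖q ^ n‖ < 1 := by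
  rw [norm_pow]
  exact pow_lt_one₀ (norm_nonneg _) hq hn

theorem qPochInf_sq_base (a : ℂ) {q : ℂ} (hq : ‖q‖ < 1) :
    qPochInf a q = qPochInf a (q ^ 2) * qPochInf (a * q) (q ^ 2) := by
  have hq2 := norm_pow_lt_one hq two_ne_zero
  refine tendsto_nhds_unique ((qPoch_tendsto a hq).comp
    (tendsto_id.const_mul_atTop' (show 0 < 2 by norm_num)))
    (((qPoch_tendsto a hq2).mul (qPoch_tendsto (a * q) hq2)).congr fun n => ?_)
  simp [qPoch_two_mul]

theorem qPochInf_cube_base (a : ℂ) {q : ℂ} (hq : ‖q‖ < 1) : qPochInf a q =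
    qPochInf a (q ^ 3) * qPochInf (a * q) (q ^ 3) * qPochInf (a * q ^ 2) (q ^ 3) := by
  have hq3 := norm_pow_lt_one hq three_ne_zero
  refine tendsto_nhds_unique ((qPoch_tendsto a hq).comp
    (tendsto_id.const_mul_atTop' (show 0 < 3 by norm_num)))
    ((((qPoch_tendsto a hq3).mul (qPoch_tendsto (a * q) hq3)).mul
      (qPoch_tendsto (a * q ^ 2) hq3)).congr fun n => ?_)
  simp [qPoch_three_mul]

theorem qPoch_mul_qPoch_neg (a q : ℂ) (n : ℕ) :
    qPoch a q n * qPoch (-a) q n = qPoch (a ^ 2) (q ^ 2) n := by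
  simp only [qPoch, ← Finset.prod_mul_distrib]
  exact Finset.prod_congr rfl fun i _ => by ring

theorem qPochInf_mul_qPochInf_neg (a : ℂ) {q : ℂ} (hq : ‖q‖ < 1) :
    qPochInf a q * qPochInf (-a) q = qPochInf (a ^ 2) (q ^ 2) :=
  tendsto_nhds_unique (((qPoch_tendsto a hq).mul (qPoch_tendsto (-a) hq)).congr
    (qPoch_mul_qPoch_neg a q)) (qPoch_tendsto _ (norm_pow_lt_one hq two_ne_zero))

theorem IsPrimitiveRoot.one_add_add_sq {ω : ℂ} (hω : IsPrimitiveRoot ω 3) :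
    1 + ω + ω ^ 2 = 0 := by
  simpa [Finset.sum_range_succ] using hω.geom_sum_eq_zero (by norm_num)

theorem qPoch_cube_root {ω : ℂ} (hω : IsPrimitiveRoot ω 3) (a q : ℂ) (n : ℕ) :
    qPoch a q n * qPoch (a * ω) q n * qPoch (a * ω ^ 2) q n = qPoch (a ^ 3) (q ^ 3) n := by
  simp only [qPoch, ← Finset.prod_mul_distrib]
  refine Finset.prod_congr rfl fun i _ => ?_
  have h1 := hω.one_add_add_sq
  have h3 := hω.pow_eq_one
  linear_combination (-(a * q ^ i) + (a * q ^ i) ^ 2 * ω) * h1 + (- (a * q ^ i) ^ 3) * h3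

theorem qPochInf_cube_root {ω : ℂ} (hω : IsPrimitiveRoot ω 3) (a : ℂ) {q : ℂ} (hq : ‖q‖ < 1) :
    qPochInf a q * qPochInf (a * ω) q * qPochInf (a * ω ^ 2) q = qPochInf (a ^ 3) (q ^ 3) :=
  tendsto_nhds_unique ((((qPoch_tendsto a hq).mul (qPoch_tendsto (a * ω) hq)).mul
    (qPoch_tendsto (a * ω ^ 2) hq)).congr
    (qPoch_cube_root hω a q)) (qPoch_tendsto _ (norm_pow_lt_one hq three_ne_zero))

theorem exists_norm_qPoch_le (a : ℂ) {q : ℂ} (hq : ‖q‖ < 1) : ∃ C, ∀ n, ‖qPoch a q n‖ ≤ C := by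
  obtain ⟨C, hC⟩ := (Metric.isBounded_range_of_tendsto _ (qPoch_tendsto a hq)).exists_norm_le
  exact ⟨C, fun n => hC _ ⟨n, rfl⟩⟩

theorem exists_norm_inv_qPoch_le {a q : ℂ} (ha : ‖a‖ < 1) (hq : ‖q‖ < 1) :
    ∃ C, ∀ n, ‖(qPoch a q n)⁻¹‖ ≤ C := by
  obtain ⟨C, hC⟩ := (Metric.isBounded_range_of_tendsto _
    ((qPoch_tendsto a hq).inv₀ (qPochInf_ne_zero ha hq))).exists_norm_le
  exact ⟨C, fun n => hC _ ⟨n, rfl⟩⟩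

/-! ### The `q`-binomial theorem and the interchange of summations -/

theorem summable_norm_bounded_mul_pow {c : ℕ → ℂ} {C : ℝ} (hc : ∀ n, ‖c n‖ ≤ C) {z : ℂ}
    (hz : ‖z‖ < 1) : Summable fun n => ‖c n * z ^ n‖ := by
  refine Summable.of_nonneg_of_le (fun _ => norm_nonneg _) (fun n => ?_)
    ((summable_geometric_of_lt_one (norm_nonneg z) hz).mul_left C)
  rw [norm_mul, norm_pow]
  exact mul_le_mul_of_nonneg_right (hc n) (by positivity)

theorem exists_norm_qPoch_div_le (a : ℂ) {q : ℂ} (hq : ‖q‖ < 1) :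
    ∃ C, ∀ n, ‖qPoch a q n / qPoch q q n‖ ≤ C := by
  obtain ⟨C, hC⟩ := exists_norm_qPoch_le a hq
  obtain ⟨D, hD⟩ := exists_norm_inv_qPoch_le hq hq
  refine ⟨C * D, fun n => ?_⟩
  rw [div_eq_mul_inv, norm_mul]
  exact mul_le_mul (hC n) (hD n) (norm_nonneg _) ((norm_nonneg _).trans (hC n))

theorem summable_norm_qBinomial (a : ℂ) {q z : ℂ} (hq : ‖q‖ < 1) (hz : ‖z‖ < 1) :
    Summable fun n => ‖qPoch a q n / qPoch q q n * z ^ n‖ := by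
  obtain ⟨C, hC⟩ := exists_norm_qPoch_div_le a hq
  exact summable_norm_bounded_mul_pow hC hz

/-- A power series with bounded coefficients is continuous along `z q^N → 0`. -/
theorem tendsto_tsum_mul_pow {c : ℕ → ℂ} {C : ℝ} (hc : ∀ n, ‖c n‖ ≤ C) {z q : ℂ} (hz : ‖z‖ < 1)
    (hq : ‖q‖ < 1) : Tendsto (fun N : ℕ => ∑' n, c n * (z * q ^ N) ^ n) atTop (𝓝 (c 0)) := by
  have h0 : ∑' n, (if n = 0 then c 0 else 0) = c 0 := by simp
  rw [← h0]
  refine tendsto_tsum_of_dominated_convergence (summable_norm_bounded_mul_pow hc hz) ?_ ?_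
  · intro n
    rcases eq_or_ne n 0 with rfl | hn
    · simp
    · have h : Tendsto (fun N : ℕ => z * q ^ N) atTop (𝓝 0) := by
        simpa using (tendsto_pow_atTop_nhds_zero_of_norm_lt_one hq).const_mul z
      simpa [hn] using (h.pow n).const_mul (c n)
  · refine Eventually.of_forall fun N n => ?_
    rw [norm_mul, norm_mul, norm_pow, norm_pow, norm_mul, norm_pow]
    gcongr
    exact mul_le_of_le_one_right (norm_nonneg _) (pow_le_one₀ (norm_nonneg _) hq.le)

/-- The functional equation relating the values of the `q`-binomial series at `z` and `zq`;
iterating it gives the `q`-binomial theorem. -/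
theorem tsum_qBinomial_step (a : ℂ) {q z : ℂ} (hq : ‖q‖ < 1) (hz : ‖z‖ < 1) :
    (1 - z) * ∑' n, qPoch a q n / qPoch q q n * z ^ n =
      (1 - a * z) * ∑' n, qPoch a q n / qPoch q q n * (z * q) ^ n := by
  have hzq : ‖z * q‖ < 1 := by simpa using norm_mul_pow_lt_one hz hq 1
  have h1 := (summable_norm_qBinomial a hq hz).of_norm
  have h2 := (summable_norm_qBinomial a hq hzq).of_norm
  have h3 : ∑' n, qPoch a q n / qPoch q q n * z ^ n -
      ∑' n, qPoch a q n / qPoch q q n * (z * q) ^ n =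
      z * ∑' n, qPoch a q n / qPoch q q n * z ^ n -
      a * z * ∑' n, qPoch a q n / qPoch q q n * (z * q) ^ n := by
    rw [← h1.tsum_sub h2, ← tsum_mul_left, ← tsum_mul_left,
      ← (h1.mul_left z).tsum_sub (h2.mul_left (a * z)), (h1.sub h2).tsum_eq_zero_add]
    simp only [pow_zero, sub_self, zero_add]
    refine tsum_congr fun n => ?_
    have hn := qPoch_ne_zero hq hq n
    have hn1 := one_sub_ne_zero_of_norm_lt_one (norm_mul_pow_lt_one hq hq n)
    rw [qPoch_succ, qPoch_succ, mul_pow, mul_pow, pow_succ z, pow_succ q]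
    rw [mul_comm q] at hn1
    rw [mul_comm q]
    generalize q ^ n = x at *
    field_simp
  linear_combination h3

/-- The `q`-binomial theorem `∑ (a;q)_n / (q;q)_n z^n = (az;q)_∞ / (z;q)_∞`. -/
theorem hasSum_qBinomial (a : ℂ) {q z : ℂ} (hq : ‖q‖ < 1) (hz : ‖z‖ < 1) :
    HasSum (fun n => qPoch a q n / qPoch q q n * z ^ n) (qPochInf (a * z) q / qPochInf z q) := by
  have key : ∀ N : ℕ, qPoch z q N * ∑' n, qPoch a q n / qPoch q q n * z ^ n =
      qPoch (a * z) q N * ∑' n, qPoch a q n / qPoch q q n * (z * q ^ N) ^ n := by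
    intro N
    induction N with
    | zero => simp
    | succ N ih =>
      have h := tsum_qBinomial_step a hq (norm_mul_pow_lt_one hz hq N)
      rw [qPoch_succ, qPoch_succ, pow_succ, ← mul_assoc z]
      linear_combination (1 - z * q ^ N) * ih + qPoch (a * z) q N * h
  obtain ⟨C, hC⟩ := exists_norm_qPoch_div_le a hq
  have hl := (qPoch_tendsto z hq).mul_const (∑' n, qPoch a q n / qPoch q q n * z ^ n)
  have hr := (qPoch_tendsto (a * z) hq).mul (tendsto_tsum_mul_pow hC hz hq)
  have h := tendsto_nhds_unique (hl.congr key) hr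
  simp only [qPoch_zero, div_one, mul_one] at h
  rw [← h, mul_div_cancel_left₀ _ (qPochInf_ne_zero hz hq)]
  exact (summable_norm_qBinomial a hq hz).of_norm.hasSum

/-- Expanding a quotient of infinite products by the `q`-binomial theorem inside a sum and
interchanging the summations, which is the step behind Heine's transformations. -/
theorem tsum_mul_qPochInf_div {A w : ℕ → ℂ} (hA : Summable fun n => ‖A n‖)
    (hw : ∀ n, ‖w n‖ ≤ 1) (b : ℂ) {q y : ℂ} (hq : ‖q‖ < 1) (hy : ‖y‖ < 1) :
    ∑' n, A n * (qPochInf (b * (y * w n)) q / qPochInf (y * w n) q) =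
      ∑' m, qPoch b q m / qPoch q q m * y ^ m * ∑' n, A n * w n ^ m := by
  have hyw : ∀ n, ‖y * w n‖ < 1 := fun n => by
    rw [norm_mul]
    exact (mul_le_of_le_one_right (norm_nonneg _) (hw n)).trans_lt hy
  have hs : Summable fun x : ℕ × ℕ =>
      A x.1 * (qPoch b q x.2 / qPoch q q x.2 * (y * w x.1) ^ x.2) := by
    refine Summable.of_norm_bounded (hA.mul_norm (summable_norm_qBinomial b hq hy)) fun x => ?_
    have h : ‖(y * w x.1) ^ x.2‖ ≤ ‖y ^ x.2‖ := by
      rw [norm_pow, norm_pow, norm_mul]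
      gcongr
      exact mul_le_of_le_one_right (norm_nonneg _) (hw _)
    rw [norm_mul, norm_mul, norm_mul (A x.1), norm_mul (_ / _)]
    gcongr
  have h1 : ∀ n, A n * (qPochInf (b * (y * w n)) q / qPochInf (y * w n) q) =
      ∑' m, A n * (qPoch b q m / qPoch q q m * (y * w n) ^ m) := fun n => by
    rw [tsum_mul_left, (hasSum_qBinomial b hq (hyw n)).tsum_eq]
  have h2 : ∀ m, qPoch b q m / qPoch q q m * y ^ m * ∑' n, A n * w n ^ m =
      ∑' n, A n * (qPoch b q m / qPoch q q m * (y * w n) ^ m) := fun m => by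
    rw [← tsum_mul_left]
    exact tsum_congr fun n => by rw [mul_pow]; ring
  rw [tsum_congr h1, tsum_congr h2]
  exact (Summable.tsum_comm (f := fun n m => A n * (qPoch b q m / qPoch q q m * (y * w n) ^ m))
    hs).symm

/-! ### Formal power series and their `q`-difference equations -/

open PowerSeries in
/-- A formal power series is determined by its constant term and an equation
`P(X) φ(pX) = Q(X) φ(X)` with `P(0) = Q(0) = 1`. -/
theorem eq_of_rescale_eq {p : ℂ} (hp : ∀ n : ℕ, n ≠ 0 → p ^ n ≠ 1) {P Q φ ψ : ℂ⟦X⟧}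
    (hP : coeff 0 P = 1) (hQ : coeff 0 Q = 1) (hφ : P * rescale p φ = Q * φ)
    (hψ : P * rescale p ψ = Q * ψ) (h0 : coeff 0 φ = coeff 0 ψ) : φ = ψ := by
  have hδ : P * rescale p (φ - ψ) = Q * (φ - ψ) := by
    rw [map_sub]; linear_combination hφ - hψ
  rw [← sub_eq_zero]
  ext n
  induction n using Nat.strong_induction_on with
  | _ n ih =>
    rcases eq_or_ne n 0 with rfl | hn
    · rw [map_sub, h0, sub_self, map_zero]
    have h := congrArg (coeff n) hδ
    have hs : ∀ R χ : ℂ⟦X⟧, (∀ m < n, coeff m χ = 0) → coeff 0 R = 1 →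
        coeff n (R * χ) = coeff n χ := by
      intro R χ hχ hR
      rw [coeff_mul, Finset.sum_eq_single (0, n)]
      · simp only [hR, one_mul]
      · rintro ⟨i, j⟩ hij hne
        rw [Finset.HasAntidiagonal.mem_antidiagonal] at hij
        rcases eq_or_ne i 0 with rfl | hi
        · simp_all
        · rw [hχ j (by simp only at hij; omega), mul_zero]
      · simp
    have hz : ∀ m < n, coeff m (φ - ψ) = 0 := fun m hm => by simpa using ih m hm
    rw [hs P _ (fun m hm => by rw [coeff_rescale, hz m hm, mul_zero]) hP, hs Q _ hz hQ,
      coeff_rescale] at h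
    have h' : (p ^ n - 1) * coeff n (φ - ψ) = 0 := by linear_combination h
    rcases mul_eq_zero.1 h' with h'' | h''
    · exact absurd (sub_eq_zero.1 h'') (hp n hn)
    · simpa using h''

theorem pow_ne_one_of_norm_lt_one {q : ℂ} (hq : ‖q‖ < 1) (n : ℕ) (hn : n ≠ 0) : q ^ n ≠ 1 := by
  intro h
  have := norm_pow_lt_one hq hn
  simp [h] at this

/-- The formal power series `∑ α^n X^n / (q;q)_n`, the expansion of `1 / (αX;q)_∞`. -/
noncomputable def qExp (q α : ℂ) : PowerSeries ℂ := PowerSeries.mk fun n => α ^ n / qPoch q q n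

/-- The formal power series `∑ (-α)^n q^{n(n-1)/2} X^n / (q;q)_n`, the expansion of
`(αX;q)_∞`. -/
noncomputable def qExpInv (q α : ℂ) : PowerSeries ℂ :=
  PowerSeries.mk fun n => (-α) ^ n * q ^ n.choose 2 / qPoch q q n

open PowerSeries in
theorem coeff_one_sub_C_mul_X_mul (α : ℂ) (φ : ℂ⟦X⟧) (n : ℕ) :
    coeff (n + 1) ((1 - C α * X) * φ) = coeff (n + 1) φ - α * coeff n φ := by
  rw [sub_mul, one_mul, map_sub, mul_assoc, coeff_C_mul, coeff_succ_X_mul]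

open PowerSeries in
theorem rescale_qExp {q : ℂ} (hq : ‖q‖ < 1) (α : ℂ) :
    rescale q (qExp q α) = (1 - C α * X) * qExp q α := by
  ext n
  cases n with
  | zero => simp [qExp]
  | succ n =>
    have hn := qPoch_ne_zero hq hq n
    have hn1 := one_sub_ne_zero_of_norm_lt_one (norm_mul_pow_lt_one hq hq n)
    rw [coeff_one_sub_C_mul_X_mul]
    simp only [qExp, coeff_rescale, coeff_mk, qPoch_succ, pow_succ]
    rw [mul_comm q] at *
    generalize q ^ n = x at *
    field_simp
    ring

open PowerSeries in
theorem qExpInv_eq {q : ℂ} (hq : ‖q‖ < 1) (α : ℂ) :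
    qExpInv q α = (1 - C α * X) * rescale q (qExpInv q α) := by
  ext n
  cases n with
  | zero =>
    rw [coeff_mul]
    simp only [Finset.HasAntidiagonal.antidiagonal_zero, Finset.sum_singleton, coeff_rescale]
    simp [qExpInv]
  | succ n =>
    have hn := qPoch_ne_zero hq hq n
    have hn1 := one_sub_ne_zero_of_norm_lt_one (norm_mul_pow_lt_one hq hq n)
    rw [coeff_one_sub_C_mul_X_mul]
    simp only [qExpInv, coeff_rescale, coeff_mk, qPoch_succ, pow_succ, Nat.choose_succ_succ' n 1,
      Nat.choose_one_right, pow_add]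
    rw [mul_comm q] at *
    generalize q ^ n = x at *
    field_simp
    ring

open PowerSeries in
theorem qExp_mul_qExpInv {q : ℂ} (hq : ‖q‖ < 1) (α : ℂ) : qExp q α * qExpInv q α = 1 := by
  refine eq_of_rescale_eq (P := 1) (Q := 1) (pow_ne_one_of_norm_lt_one hq) (by simp) (by simp)
    ?_ (by simp) (by simp [qExp, qExpInv, coeff_mul])
  rw [map_mul, rescale_qExp hq, one_mul, one_mul]
  linear_combination - qExp q α * qExpInv_eq hq α

/-! ### Products and sums of coefficients -/

open PowerSeries in
/-- Regrouping of a double sum by the value of `i + j`. -/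
theorem tsum_coeff_mul {f : ℕ → ℂ} {φ ψ : ℂ⟦X⟧}
    (h : Summable fun x : ℕ × ℕ => f (x.1 + x.2) * (coeff x.1 φ * coeff x.2 ψ)) :
    ∑' n, f n * coeff n (φ * ψ) = ∑' x : ℕ × ℕ, f (x.1 + x.2) * (coeff x.1 φ * coeff x.2 ψ) := by
  rw [← Finset.HasAntidiagonal.sigmaAntidiagonalEquivProd.tsum_eq
    (fun x : ℕ × ℕ => f (x.1 + x.2) * (coeff x.1 φ * coeff x.2 ψ))]
  rw [← Finset.HasAntidiagonal.sigmaAntidiagonalEquivProd.summable_iff] at h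
  refine Eq.trans ?_ (h.tsum_sigma' fun n => (hasSum_fintype _).summable).symm
  refine tsum_congr fun n => ?_
  rw [coeff_mul, Finset.mul_sum, tsum_fintype, ← Finset.sum_coe_sort]
  refine Finset.sum_congr rfl fun x _ => ?_
  have := Finset.HasAntidiagonal.mem_antidiagonal.1 x.2
  simp [this]

open PowerSeries in
theorem tsum_coeff_mul_mul_pow {φ ψ : ℂ⟦X⟧} {z : ℂ} (hφ : Summable fun n => ‖coeff n φ * z ^ n‖)
    (hψ : Summable fun n => ‖coeff n ψ * z ^ n‖) :
    (Summable fun n => ‖coeff n (φ * ψ) * z ^ n‖) ∧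
    ∑' n, coeff n (φ * ψ) * z ^ n = (∑' n, coeff n φ * z ^ n) * ∑' n, coeff n ψ * z ^ n := by
  have h : ∀ n, ∑ x ∈ Finset.HasAntidiagonal.antidiagonal n,
      coeff x.1 φ * z ^ x.1 * (coeff x.2 ψ * z ^ x.2) = coeff n (φ * ψ) * z ^ n := by
    intro n
    rw [coeff_mul, Finset.sum_mul]
    refine Finset.sum_congr rfl fun x hx => ?_
    rw [← Finset.HasAntidiagonal.mem_antidiagonal.1 hx]
    ring
  constructor
  · simpa only [h] using summable_norm_sum_mul_antidiagonal_of_summable_norm hφ hψ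
  · rw [tsum_mul_tsum_eq_tsum_sum_antidiagonal_of_summable_norm hφ hψ]
    simp only [h]

theorem summable_norm_qExp {q z : ℂ} (hq : ‖q‖ < 1) (hz : ‖z‖ < 1) :
    Summable fun n => ‖PowerSeries.coeff n (qExp q 1) * z ^ n‖ := by
  simpa [qExp] using summable_norm_qBinomial 0 hq hz

theorem tsum_qExp {q z : ℂ} (hq : ‖q‖ < 1) (hz : ‖z‖ < 1) :
    ∑' n, PowerSeries.coeff n (qExp q 1) * z ^ n = 1 / qPochInf z q := by
  simpa [qExp] using (hasSum_qBinomial 0 hq hz).tsum_eq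

theorem summable_norm_qExpInv {q z : ℂ} (hq : ‖q‖ < 1) (hz : ‖z‖ < 1) :
    Summable fun n => ‖PowerSeries.coeff n (qExpInv q 1) * z ^ n‖ := by
  obtain ⟨C, hC⟩ := exists_norm_inv_qPoch_le hq hq
  refine summable_norm_bounded_mul_pow (C := C) (fun n => ?_) hz
  rw [qExpInv, PowerSeries.coeff_mk, div_eq_mul_inv, norm_mul]
  refine (mul_le_of_le_one_left (norm_nonneg _) ?_).trans (hC n)
  simpa using pow_le_one₀ (norm_nonneg _) hq.le

theorem tsum_qExpInv {q z : ℂ} (hq : ‖q‖ < 1) (hz : ‖z‖ < 1) :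
    ∑' n, PowerSeries.coeff n (qExpInv q 1) * z ^ n = qPochInf z q := by
  have h := (tsum_coeff_mul_mul_pow (summable_norm_qExp hq hz) (summable_norm_qExpInv hq hz)).2
  rw [qExp_mul_qExpInv hq, tsum_qExp hq hz, tsum_eq_single 0 (by
    intro n hn; simp [PowerSeries.coeff_one, hn])] at h
  have h0 := qPochInf_ne_zero hz hq
  field_simp at h
  simpa using h.symm

/-! ### Euler's transformation of `₂φ₁` -/

/-- The formal power series `₂φ₁(a, b; c; p, X)`. -/
noncomputable def twoPhiOneSeries (a b c p : ℂ) : PowerSeries ℂ :=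
  PowerSeries.mk fun n => qPoch a p n * qPoch b p n / (qPoch p p n * qPoch c p n)

open PowerSeries in
/-- The second-order `q`-difference equation of `₂φ₁`, multiplied by `p`. -/
theorem twoPhiOneSeries_eq (a b : ℂ) {c p : ℂ} (hc : ‖c‖ < 1) (hp : ‖p‖ < 1) :
    C p * twoPhiOneSeries a b c p - C (p + c) * rescale p (twoPhiOneSeries a b c p) +
      C c * rescale p (rescale p (twoPhiOneSeries a b c p)) =
    X * (C p * (twoPhiOneSeries a b c p - C (a + b) * rescale p (twoPhiOneSeries a b c p) +
      C (a * b) * rescale p (rescale p (twoPhiOneSeries a b c p)))) := by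
  ext n
  cases n with
  | zero =>
    rw [coeff_zero_X_mul]
    simp only [map_add, map_sub, add_mul, coeff_C_mul, coeff_rescale]
    simp [twoPhiOneSeries]
  | succ n =>
    have hn1 := one_sub_ne_zero_of_norm_lt_one (norm_mul_pow_lt_one hp hp n)
    have hn3 := one_sub_ne_zero_of_norm_lt_one (norm_mul_pow_lt_one hc hp n)
    have hu : coeff (n + 1) (twoPhiOneSeries a b c p) * ((1 - p * p ^ n) * (1 - c * p ^ n)) =
        coeff n (twoPhiOneSeries a b c p) * ((1 - a * p ^ n) * (1 - b * p ^ n)) := by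
      have hn := qPoch_ne_zero hp hp n
      have hn2 := qPoch_ne_zero hc hp n
      simp only [twoPhiOneSeries, coeff_mk, qPoch_succ]
      rw [div_mul_eq_mul_div, div_mul_eq_mul_div, div_eq_div_iff (by positivity) (by positivity)]
      ring
    rw [coeff_succ_X_mul]
    simp only [map_add, map_sub, add_mul, coeff_C_mul, coeff_rescale]
    linear_combination p * hu

open PowerSeries in
/-- The coefficient of `z^n` in `(z;p)_∞ ₂φ₁(a, b; c; p, z)`. -/
noncomputable def eulerCoeff (a b c p : ℂ) (n : ℕ) : ℂ :=
  coeff n (qExpInv p 1 * twoPhiOneSeries a b c p)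

open PowerSeries in
/-- The second-order `q`-difference equation of `H(z) = (z;p)_∞ ₂φ₁(a, b; c; p, z)`, expanded in
powers of `X` so that coefficients can be read off. -/
theorem qExpInv_mul_twoPhiOneSeries_eq (a b : ℂ) {c p : ℂ} (hc : ‖c‖ < 1) (hp : ‖p‖ < 1)
    {H : ℂ⟦X⟧} (hH : H = qExpInv p 1 * twoPhiOneSeries a b c p) :
    C p * H - C (p + c) * rescale p H + X * (C (p * (a + b)) * rescale p H) +
      C c * rescale p (rescale p H) - X * (C (p * (a * b) + c * p) * rescale p (rescale p H)) +
      X * (X * (C (p ^ 2 * (a * b)) * rescale p (rescale p H))) = 0 := by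
  have h1 := qExpInv_eq hp 1
  have h2 := congrArg (rescale p) h1
  simp only [map_mul, map_sub, map_one, rescale_X, one_mul] at h1 h2
  have h3 := twoPhiOneSeries_eq a b hc hp
  subst hH
  simp only [map_mul, map_add, map_pow] at *
  generalize rescale p (rescale p (qExpInv p 1)) = E2 at *
  generalize rescale p (qExpInv p 1) = E1 at *
  rw [h2] at h1 ⊢
  rw [h1]
  linear_combination (1 - C p * X) * E2 * h3

theorem eulerCoeff_zero (a b c p : ℂ) : eulerCoeff a b c p 0 = 1 := by
  simp [eulerCoeff, PowerSeries.coeff_mul, qExpInv, twoPhiOneSeries]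

open PowerSeries in
theorem eulerCoeff_one (a b : ℂ) {c p : ℂ} (hc : ‖c‖ < 1) (hp : ‖p‖ < 1) (hp0 : p ≠ 0) :
    (1 - p) * (1 - c) * eulerCoeff a b c p 1 = (a * b + c) - (a + b) := by
  have e : ∀ n, coeff n (qExpInv p 1 * twoPhiOneSeries a b c p) = eulerCoeff a b c p n :=
    fun _ => rfl
  have h := congrArg (coeff (0 + 1)) (qExpInv_mul_twoPhiOneSeries_eq a b hc hp rfl)
  simp only [map_add, map_sub, map_zero, add_mul, mul_add, coeff_succ_X_mul, coeff_zero_X_mul,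
    coeff_C_mul, coeff_rescale, e, eulerCoeff_zero, zero_add] at h
  apply mul_left_cancel₀ hp0
  linear_combination h

open PowerSeries in
theorem eulerCoeff_add_two (a b : ℂ) {c p : ℂ} (hc : ‖c‖ < 1) (hp : ‖p‖ < 1) (hp0 : p ≠ 0)
    (n : ℕ) :
    (1 - p ^ (n + 2)) * (1 - c * p ^ (n + 1)) * eulerCoeff a b c p (n + 2) =
      ((a * b + c) * p ^ (2 * n + 2) - (a + b) * p ^ (n + 1)) * eulerCoeff a b c p (n + 1) -
      a * b * p ^ (2 * n + 1) * eulerCoeff a b c p n := by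
  have e : ∀ n, coeff n (qExpInv p 1 * twoPhiOneSeries a b c p) = eulerCoeff a b c p n :=
    fun _ => rfl
  have h := congrArg (coeff (n + 1 + 1)) (qExpInv_mul_twoPhiOneSeries_eq a b hc hp rfl)
  simp only [map_add, map_sub, map_zero, add_mul, mul_add, coeff_succ_X_mul, coeff_C_mul,
    coeff_rescale, e] at h
  apply mul_left_cancel₀ hp0
  linear_combination h

/-- The recurrence of `eulerCoeff` only involves `a + b`, `ab + c` and `ab`, so it is invariant
under `a ↦ c / a`, `b ↦ c / b`, up to a rescaling by `μ = ab / c`. -/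
theorem eulerCoeff_symm {a b a' b' c p μ : ℂ} (hc : ‖c‖ < 1) (hp : ‖p‖ < 1) (hp0 : p ≠ 0)
    (h1 : (a' + b') * μ = a + b) (h2 : (a' * b' + c) * μ = a * b + c)
    (h3 : a' * b' * μ ^ 2 = a * b) (n : ℕ) :
    eulerCoeff a' b' c p n * μ ^ n = eulerCoeff a b c p n := by
  induction n using Nat.twoStepInduction with
  | zero => simp [eulerCoeff_zero]
  | one =>
    have hne : (1 - p) * (1 - c) ≠ 0 := mul_ne_zero (one_sub_ne_zero_of_norm_lt_one hp)
      (one_sub_ne_zero_of_norm_lt_one hc)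
    apply mul_left_cancel₀ hne
    linear_combination μ * eulerCoeff_one a' b' hc hp hp0 - eulerCoeff_one a b hc hp hp0 + h2 - h1
  | more n ih0 ih1 =>
    have hne : (1 - p ^ (n + 2)) * (1 - c * p ^ (n + 1)) ≠ 0 :=
      mul_ne_zero (one_sub_ne_zero_of_norm_lt_one (norm_pow_lt_one hp (by omega)))
        (one_sub_ne_zero_of_norm_lt_one (norm_mul_pow_lt_one hc hp _))
    apply mul_left_cancel₀ hne
    rw [eulerCoeff_add_two a b hc hp hp0, ← ih0, ← ih1]
    linear_combination μ ^ (n + 2) * eulerCoeff_add_two a' b' hc hp hp0 n +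
      μ ^ (n + 1) * eulerCoeff a' b' c p (n + 1) * (p ^ (2 * n + 2) * h2 - p ^ (n + 1) * h1) -
      μ ^ n * eulerCoeff a' b' c p n * p ^ (2 * n + 1) * h3

theorem exists_norm_twoPhiOne_coeff_le (a b : ℂ) {c p : ℂ} (hc : ‖c‖ < 1) (hp : ‖p‖ < 1) :
    ∃ K, ∀ n, ‖qPoch a p n * qPoch b p n / (qPoch p p n * qPoch c p n)‖ ≤ K := by
  obtain ⟨A, hA⟩ := exists_norm_qPoch_div_le a hp
  obtain ⟨B, hB⟩ := exists_norm_qPoch_le b hp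
  obtain ⟨D, hD⟩ := exists_norm_inv_qPoch_le hc hp
  refine ⟨A * (B * D), fun n => ?_⟩
  have hA0 := (norm_nonneg _).trans (hA n)
  have hB0 := (norm_nonneg _).trans (hB n)
  rw [mul_div_mul_comm, norm_mul, div_eq_mul_inv (qPoch b p n), norm_mul (qPoch b p n)]
  exact mul_le_mul (hA n) (mul_le_mul (hB n) (hD n) (norm_nonneg _) hB0) (by positivity) hA0

theorem summable_norm_twoPhiOneTerm (a b : ℂ) {c p z : ℂ} (hc : ‖c‖ < 1) (hp : ‖p‖ < 1)
    (hz : ‖z‖ < 1) : Summable fun n => ‖twoPhiOneTerm a b c p z n‖ := by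
  obtain ⟨K, hK⟩ := exists_norm_twoPhiOne_coeff_le a b hc hp
  exact summable_norm_bounded_mul_pow hK hz

theorem tsum_eulerCoeff (a b : ℂ) {c p z : ℂ} (hc : ‖c‖ < 1) (hp : ‖p‖ < 1) (hz : ‖z‖ < 1) :
    (Summable fun n => ‖eulerCoeff a b c p n * z ^ n‖) ∧
    ∑' n, eulerCoeff a b c p n * z ^ n = qPochInf z p * twoPhiOne a b c p z := by
  have h := tsum_coeff_mul_mul_pow (ψ := twoPhiOneSeries a b c p) (summable_norm_qExpInv hp hz)
    (by simpa only [twoPhiOneSeries, PowerSeries.coeff_mk, twoPhiOneTerm] using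
      summable_norm_twoPhiOneTerm a b hc hp hz)
  refine ⟨h.1, h.2.trans ?_⟩
  rw [tsum_qExpInv hp hz]
  simp [twoPhiOneSeries, twoPhiOne, twoPhiOneTerm]

/-- Euler's transformation
`(z;p)_∞ ₂φ₁(a, b; c; p, z) = (μz;p)_∞ ₂φ₁(c/a, c/b; c; p, μz)` with `μ = ab / c`. -/
theorem twoPhiOne_euler {a b a' b' c p μ z : ℂ} (hc : ‖c‖ < 1) (hp : ‖p‖ < 1) (hp0 : p ≠ 0)
    (h1 : (a' + b') * μ = a + b) (h2 : (a' * b' + c) * μ = a * b + c)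
    (h3 : a' * b' * μ ^ 2 = a * b) (hz : ‖z‖ < 1) (hμ : ‖μ * z‖ < 1) :
    qPochInf z p * twoPhiOne a b c p z = qPochInf (μ * z) p * twoPhiOne a' b' c p (μ * z) := by
  rw [← (tsum_eulerCoeff a b hc hp hz).2, ← (tsum_eulerCoeff a' b' hc hp hμ).2]
  refine tsum_congr fun n => ?_
  rw [← eulerCoeff_symm hc hp hp0 h1 h2 h3]
  ring

/-! ### Transformations of the series -/

/-- A quadratic transformation: the terms of the left side are those of
`₂φ₁(a, at; -t²; t², a²)`, while the right side is a `₃φ₂` series in base `t`. -/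
theorem tsum_qPoch_two_mul_eq {a t : ℂ} (ha : ‖a‖ < 1) (ht : ‖t‖ < 1) :
    ∑' n, qPoch a t (2 * n) / qPoch (t ^ 4) (t ^ 4) n * (a ^ 2) ^ n =
      qPochInf a t / qPochInf (-a) t * ∑' l, qPoch (-t) (t ^ 2) l / qPoch (t ^ 2) (t ^ 2) l *
        a ^ l * (qPochInf (-a ^ 2 * t ^ l) t / qPochInf (a * t ^ l) t) := by
  have ht2 := norm_pow_lt_one ht two_ne_zero
  have ht4 := norm_pow_lt_one ht four_ne_zero
  have ha2 := norm_pow_lt_one ha two_ne_zero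
  have hna : ‖-a‖ < 1 := by rwa [norm_neg]
  have hw : ∀ n : ℕ, ‖t ^ n‖ ≤ 1 := fun n => by
    rw [norm_pow]; exact pow_le_one₀ (norm_nonneg _) ht.le
  have hA : Summable fun n => ‖(a ^ 2) ^ n / qPoch (t ^ 4) (t ^ 4) n‖ := by
    refine (summable_norm_qBinomial 0 ht4 ha2).congr fun n => ?_
    rw [qPoch_zero_left, one_div_mul_eq_div]
  have hB : Summable fun n => ‖qPoch (-a) t n / qPoch t t n * a ^ n‖ :=
    summable_norm_qBinomial (-a) ht ha
  have h1 : ∀ n, qPoch a t (2 * n) / qPoch (t ^ 4) (t ^ 4) n * (a ^ 2) ^ n =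
      qPochInf a t * ((a ^ 2) ^ n / qPoch (t ^ 4) (t ^ 4) n *
        (qPochInf (0 * (a * t ^ (2 * n))) t / qPochInf (a * t ^ (2 * n)) t)) := fun n => by
    rw [qPoch_eq_div ha ht, zero_mul, qPochInf_zero_left]
    ring
  have h2 : ∀ m, qPoch 0 t m / qPoch t t m * a ^ m *
      ∑' n, (a ^ 2) ^ n / qPoch (t ^ 4) (t ^ 4) n * (t ^ (2 * n)) ^ m =
      (qPochInf (-a) t)⁻¹ * (qPoch (-a) t m / qPoch t t m * a ^ m *
        (qPochInf (-t * (a * t ^ m)) (t ^ 2) / qPochInf (a * t ^ m) (t ^ 2))) := fun m => by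
    have ham := norm_mul_pow_lt_one ha ht m
    have hnam : ‖-(a * t ^ m)‖ < 1 := by rwa [norm_neg]
    have e1 : ∑' n, (a ^ 2) ^ n / qPoch (t ^ 4) (t ^ 4) n * (t ^ (2 * n)) ^ m =
        1 / qPochInf ((a * t ^ m) ^ 2) (t ^ 4) := by
      have := (hasSum_qBinomial 0 ht4 (norm_pow_lt_one ham two_ne_zero)).tsum_eq
      rw [zero_mul, qPochInf_zero_left] at this
      rw [← this]
      refine tsum_congr fun n => ?_
      rw [qPoch_zero_left]
      ring
    have e2 := qPochInf_mul_qPochInf_neg (a * t ^ m) ht2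
    have e3 := qPochInf_sq_base (-(a * t ^ m)) ht
    have e4 := qPochInf_eq_qPoch_mul (-a) ht m
    rw [show (t ^ 2) ^ 2 = t ^ 4 by ring] at e2
    rw [show -(a * t ^ m) * t = -t * (a * t ^ m) by ring] at e3
    rw [neg_mul] at e4
    rw [e1, ← e2, e4, qPoch_zero_left]
    have n1 := qPochInf_ne_zero ham ht2
    have n2 := qPochInf_ne_zero hnam ht2
    have n3 := qPochInf_ne_zero hnam ht
    have n4 := qPoch_ne_zero hna ht m
    have n5 := qPoch_ne_zero ht ht m
    field_simp
    rw [e3, show -(a * t ^ m * t) = -t * (a * t ^ m) by ring]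
    ring
  have h3 : ∀ l, ∑' m, qPoch (-a) t m / qPoch t t m * a ^ m * (t ^ m) ^ l =
      qPochInf (-a ^ 2 * t ^ l) t / qPochInf (a * t ^ l) t := fun l => by
    rw [show -a ^ 2 * t ^ l = -a * (a * t ^ l) by ring,
      ← (hasSum_qBinomial (-a) ht (norm_mul_pow_lt_one ha ht l)).tsum_eq]
    exact tsum_congr fun n => by ring
  rw [tsum_congr h1, tsum_mul_left, tsum_mul_qPochInf_div hA (fun n => hw _) 0 ht ha,
    tsum_congr h2, tsum_mul_left, tsum_mul_qPochInf_div hB hw (-t) ht2 ha]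
  simp only [h3]
  ring

/-- A transformation of nonterminating `₃φ₂` series with a numerator parameter `a` and a
denominator parameter `e`, where `e = ya` on the left and `e = xa` on the right. The quotient
`(a;q)_n / (e;q)_n` is written, up to a constant factor, as `(eq^n;q)_∞ / (aq^n;q)_∞`. The remaining
parameters and the arguments `x`, `y = μx` are related by Euler's transformation. -/
theorem tsum_twoPhiOneTerm_mul {a b c b' c' d q x y μ : ℂ} (hq : ‖q‖ < 1) (hq0 : q ≠ 0)
    (ha : ‖a‖ < 1) (hd : ‖d‖ < 1) (hx : ‖x‖ < 1) (hy : ‖y‖ < 1) (hxy : μ * x = y)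
    (h1 : (b' + c') * μ = b + c) (h2 : (b' * c' + d) * μ = b * c + d)
    (h3 : b' * c' * μ ^ 2 = b * c) :
    ∑' n, twoPhiOneTerm b c d q x n * (qPochInf (y * (a * q ^ n)) q / qPochInf (a * q ^ n) q) =
      qPochInf y q / qPochInf x q * ∑' n, twoPhiOneTerm b' c' d q y n *
        (qPochInf (x * (a * q ^ n)) q / qPochInf (a * q ^ n) q) := by
  have hw : ∀ n : ℕ, ‖q ^ n‖ ≤ 1 := fun n => by
    rw [norm_pow]; exact pow_le_one₀ (norm_nonneg _) hq.le
  have e : ∀ (b c z : ℂ) (m : ℕ), ∑' n, twoPhiOneTerm b c d q z n * (q ^ n) ^ m =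
      twoPhiOne b c d q (z * q ^ m) := fun b c z m => by
    simp only [twoPhiOne, twoPhiOneTerm]
    exact tsum_congr fun n => by ring
  rw [tsum_mul_qPochInf_div (summable_norm_twoPhiOneTerm b c hd hq hx) hw y hq ha,
    tsum_mul_qPochInf_div (summable_norm_twoPhiOneTerm b' c' hd hq hy) hw x hq ha,
    ← tsum_mul_left]
  refine tsum_congr fun m => ?_
  have hxm := norm_mul_pow_lt_one hx hq m
  have hym := norm_mul_pow_lt_one hy hq m
  have hE := twoPhiOne_euler hd hq hq0 h1 h2 h3 hxm (by rwa [← mul_assoc, hxy])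
  rw [← mul_assoc, hxy] at hE
  rw [e, e, qPochInf_eq_qPoch_mul y hq m, qPochInf_eq_qPoch_mul x hq m]
  have n1 := qPochInf_ne_zero hxm hq
  have n2 := qPoch_ne_zero hx hq m
  rw [eq_div_of_mul_eq n1 ((mul_comm _ _).trans hE)]
  field_simp

/-! ### The summation of the `₂φ₁` series -/

theorem norm_primitiveRoot_three {ω : ℂ} (hω : IsPrimitiveRoot ω 3) : ‖ω‖ = 1 :=
  hω.norm'_eq_one (by norm_num)

/-- The value of the `₂φ₁` series with `q = s⁴`, as infinite products in base `t = -s²`. The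
series becomes a `₃φ₂` with the numerator parameters `-s, -sω, -sω²` and, including `(t;t)_n`,
the denominator parameters `t, tω, tω²`, which is a `₁φ₀` in base `t³`. -/
theorem twoPhiOne_eq_base_neg_sq {s ω : ℂ} (hs0 : s ≠ 0) (hs : ‖s‖ < 1)
    (hω : IsPrimitiveRoot ω 3) :
    twoPhiOne (s * ω) (-s ^ 3 * ω) (-s ^ 4) (s ^ 4) (s ^ 2 * ω ^ 2) =
      qPochInf (-s) (-s ^ 2) * qPochInf (-s ^ 2 * ω) (-s ^ 2) *
        qPochInf (-s ^ 2 * ω ^ 2) (-s ^ 2) * qPochInf (s ^ 4) (-s ^ 6) /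
      (qPochInf (s * ω) (-s ^ 2) * qPochInf (-(s * ω)) (-s ^ 2) * qPochInf (s ^ 2) (-s ^ 2) *
        qPochInf (-s) (-s ^ 6)) := by
  have hωn := norm_primitiveRoot_three hω
  have h3 := hω.pow_eq_one
  obtain ⟨t, ht⟩ : ∃ t, t = -s ^ 2 := ⟨_, rfl⟩
  have hs2 : ‖s ^ 2‖ < 1 := norm_pow_lt_one hs two_ne_zero
  have htn : ‖t‖ < 1 := by rwa [ht, norm_neg]
  have ht0 : t ≠ 0 := by rw [ht]; exact neg_ne_zero.2 (pow_ne_zero _ hs0)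
  have ha : ‖s * ω‖ < 1 := by rwa [norm_mul, hωn, mul_one]
  have hna : ‖-(s * ω)‖ < 1 := by rwa [norm_neg]
  have hns : ‖-s‖ < 1 := by rwa [norm_neg]
  have hd : ‖t * ω ^ 2‖ < 1 := by rwa [norm_mul, norm_pow, hωn, one_pow, mul_one]
  have hd' : ‖t * ω‖ < 1 := by rwa [norm_mul, hωn, mul_one]
  have ht3 := norm_pow_lt_one htn three_ne_zero
  have hl : twoPhiOne (s * ω) (-s ^ 3 * ω) (-s ^ 4) (s ^ 4) (s ^ 2 * ω ^ 2) =
      ∑' n, qPoch (s * ω) t (2 * n) / qPoch (t ^ 4) (t ^ 4) n * ((s * ω) ^ 2) ^ n := by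
    refine tsum_congr fun n => ?_
    have e := qPoch_mul_qPoch_neg (s ^ 4) (s ^ 4) n
    rw [twoPhiOneTerm, qPoch_two_mul, e, ht]
    ring_nf
  -- the right side of the quadratic transformation in terms of `₂φ₁` terms
  have hm : ∀ l, qPoch (-t) (t ^ 2) l / qPoch (t ^ 2) (t ^ 2) l * (s * ω) ^ l *
      (qPochInf (-(s * ω) ^ 2 * t ^ l) t / qPochInf (s * ω * t ^ l) t) =
      qPochInf (t * ω ^ 2) t * qPochInf (-s) t / (qPochInf (s * ω) t * qPochInf (s ^ 2) t) *
      (twoPhiOneTerm s (s * ω) (t * ω ^ 2) t (s * ω) l *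
        (qPochInf (-s * (-s * t ^ l)) t / qPochInf (-s * t ^ l) t)) := fun l => by
    have e1 := qPoch_mul_qPoch_neg s t l
    have e2 := qPoch_mul_qPoch_neg t t l
    rw [show s ^ 2 = -t by rw [ht]; ring] at e1 hs2 ⊢
    rw [← e1, ← e2, show -(s * ω) ^ 2 * t ^ l = t * ω ^ 2 * t ^ l by rw [ht]; ring,
      show -s * (-s * t ^ l) = -t * t ^ l by rw [ht]; ring, twoPhiOneTerm,
      qPochInf_mul_pow hd htn, qPochInf_mul_pow ha htn, qPochInf_mul_pow hs2 htn,
      qPochInf_mul_pow hns htn]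
    have n1 := qPoch_ne_zero htn htn l
    have n2 := qPoch_ne_zero hs2 htn l
    have n3 := qPoch_ne_zero ha htn l
    have n4 := qPoch_ne_zero hns htn l
    have n5 := qPoch_ne_zero hd htn l
    have n6 := qPochInf_ne_zero ha htn
    have n7 := qPochInf_ne_zero hns htn
    have n8 := qPochInf_ne_zero hs2 htn
    field_simp
  have hr : ∀ n, twoPhiOneTerm (-(s * ω ^ 2)) (-(s * ω)) (t * ω ^ 2) t (-s) n *
      (qPochInf (s * ω * (-s * t ^ n)) t / qPochInf (-s * t ^ n) t) =
      qPochInf (t * ω) t / qPochInf (-s) t *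
        (qPoch ((-s) ^ 3) (t ^ 3) n / qPoch (t ^ 3) (t ^ 3) n * (-s) ^ n) := fun n => by
    rw [← qPoch_cube_root hω, ← qPoch_cube_root hω,
      show s * ω * (-s * t ^ n) = t * ω * t ^ n by rw [ht]; ring, twoPhiOneTerm,
      qPochInf_mul_pow hd' htn, qPochInf_mul_pow hns htn, neg_mul s ω, neg_mul s (ω ^ 2)]
    have n1 := qPoch_ne_zero htn htn n
    have n2 := qPoch_ne_zero hns htn n
    have n3 := qPoch_ne_zero hd htn n
    have n4 := qPoch_ne_zero hd' htn n
    have n5 := qPochInf_ne_zero hns htn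
    field_simp
  rw [hl, tsum_qPoch_two_mul_eq ha htn, tsum_congr hm, tsum_mul_left,
    tsum_twoPhiOneTerm_mul (μ := -ω ^ 2) (b' := -(s * ω ^ 2)) (c' := -(s * ω)) htn ht0 hns hd ha hns
      (by linear_combination (-s) * h3)
      (by linear_combination (s * ω + s) * h3)
      (by rw [ht]; linear_combination (-s ^ 2 * ω ^ 2 + s ^ 2 * ω) * h3)
      (by linear_combination (s ^ 2 * ω * (ω ^ 3 + 1)) * h3),
    tsum_congr hr, tsum_mul_left, (hasSum_qBinomial _ ht3 hns).tsum_eq,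
    show (-s) ^ 3 * -s = s ^ 4 by ring, show -s ^ 6 = t ^ 3 by rw [ht]; ring, ← ht]
  have n1 := qPochInf_ne_zero ha htn
  have n2 := qPochInf_ne_zero hna htn
  have n3 := qPochInf_ne_zero hs2 htn
  have n4 := qPochInf_ne_zero hns htn
  have n5 := qPochInf_ne_zero hns ht3
  field_simp

/-- The summation of the `₂φ₁` series in terms of `s = q^{1/4}`. -/
theorem twoPhiOne_eq {s ω : ℂ} (hs0 : s ≠ 0) (hs : ‖s‖ < 1) (hω : IsPrimitiveRoot ω 3) :
    twoPhiOne (s * ω) (-s ^ 3 * ω) (-s ^ 4) (s ^ 4) (s ^ 2 * ω ^ 2) =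
      qPochInf (s ^ 12) (s ^ 24) / (qPochInf (s ^ 2 * ω ^ 2) (s ^ 4) *
        (qPochInf (-s ^ 3) (-s ^ 6) * qPochInf (s ^ 5) (-s ^ 6)) * qPochInf (s ^ 8) (s ^ 24)) := by
  have hωn := norm_primitiveRoot_three hω
  have hp : ∀ n : ℕ, n ≠ 0 → ‖s ^ n‖ < 1 := fun n hn => norm_pow_lt_one hs hn
  have hpn : ∀ n : ℕ, n ≠ 0 → ‖-s ^ n‖ < 1 := fun n hn => by rw [norm_neg]; exact hp n hn
  have h2 := hpn 2 (by norm_num)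
  have h6 := hpn 6 (by norm_num)
  have h4 := hp 4 (by norm_num)
  have h12 := hp 12 (by norm_num)
  have hns : ‖-s‖ < 1 := by rwa [norm_neg]
  have e1 : qPochInf (s * ω) (-s ^ 2) * qPochInf (-(s * ω)) (-s ^ 2) =
      qPochInf (s ^ 2 * ω ^ 2) (s ^ 4) := by
    rw [qPochInf_mul_qPochInf_neg _ h2]; ring_nf
  have e2 : qPochInf (-s ^ 2) (-s ^ 2) * qPochInf (-s ^ 2 * ω) (-s ^ 2) *
      qPochInf (-s ^ 2 * ω ^ 2) (-s ^ 2) = qPochInf (-s ^ 6) (-s ^ 6) := by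
    rw [qPochInf_cube_root hω _ h2]; ring_nf
  have e3 : qPochInf (-s ^ 2) (-s ^ 2) * qPochInf (s ^ 2) (-s ^ 2) = qPochInf (s ^ 4) (s ^ 4) := by
    have := qPochInf_mul_qPochInf_neg (-s ^ 2) h2
    rw [neg_neg] at this
    rw [this]; ring_nf
  have e4 : qPochInf (-s) (-s ^ 2) =
      qPochInf (-s) (-s ^ 6) * qPochInf (s ^ 3) (-s ^ 6) * qPochInf (-s ^ 5) (-s ^ 6) := by
    rw [qPochInf_cube_base _ h2]; ring_nf
  have f1 : qPochInf (s ^ 3) (-s ^ 6) * qPochInf (-s ^ 3) (-s ^ 6) = qPochInf (s ^ 6) (s ^ 12) := by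
    rw [qPochInf_mul_qPochInf_neg _ h6]; ring_nf
  have f2 : qPochInf (s ^ 5) (-s ^ 6) * qPochInf (-s ^ 5) (-s ^ 6) =
      qPochInf (s ^ 10) (s ^ 12) := by
    rw [qPochInf_mul_qPochInf_neg _ h6]; ring_nf
  have f3 : qPochInf (-s ^ 6) (-s ^ 6) =
      qPochInf (-s ^ 6) (s ^ 12) * qPochInf (s ^ 12) (s ^ 12) := by
    rw [qPochInf_sq_base _ h6]; ring_nf
  have f4 : qPochInf (s ^ 4) (-s ^ 6) =
      qPochInf (s ^ 4) (s ^ 12) * qPochInf (-s ^ 10) (s ^ 12) := by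
    rw [qPochInf_sq_base _ h6]; ring_nf
  have f5 : qPochInf (s ^ 6) (s ^ 12) * qPochInf (-s ^ 6) (s ^ 12) =
      qPochInf (s ^ 12) (s ^ 24) := by
    rw [qPochInf_mul_qPochInf_neg _ h12]; ring_nf
  have f6 : qPochInf (s ^ 10) (s ^ 12) * qPochInf (-s ^ 10) (s ^ 12) =
      qPochInf (s ^ 20) (s ^ 24) := by
    rw [qPochInf_mul_qPochInf_neg _ h12]; ring_nf
  have f7 : qPochInf (s ^ 8) (s ^ 12) = qPochInf (s ^ 8) (s ^ 24) * qPochInf (s ^ 20) (s ^ 24) := by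
    rw [qPochInf_sq_base _ h12]; ring_nf
  have f8 : qPochInf (s ^ 4) (s ^ 4) =
      qPochInf (s ^ 4) (s ^ 12) * qPochInf (s ^ 8) (s ^ 12) * qPochInf (s ^ 12) (s ^ 12) := by
    rw [qPochInf_cube_base _ h4]; ring_nf
  have n1 : qPochInf (s ^ 2 * ω ^ 2) (s ^ 4) ≠ 0 := qPochInf_ne_zero (by
    rw [norm_mul, norm_pow ω, hωn, one_pow, mul_one]; exact hp 2 (by norm_num)) h4
  have n2 := qPochInf_ne_zero (hpn 2 (by norm_num)) h2
  have n3 := qPochInf_ne_zero (hp 2 (by norm_num)) h2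
  have n4 := qPochInf_ne_zero hns h6
  have n5 := qPochInf_ne_zero (hpn 3 (by norm_num)) h6
  have n6 := qPochInf_ne_zero (hp 5 (by norm_num)) h6
  have n7 := qPochInf_ne_zero (hp 8 (by norm_num)) (hp 24 (by norm_num))
  -- what is left when the factors containing `ω` and those in base `-s²` have been eliminated
  have key : qPochInf (s ^ 3) (-s ^ 6) * qPochInf (-s ^ 5) (-s ^ 6) * qPochInf (-s ^ 6) (-s ^ 6) *
      qPochInf (s ^ 4) (-s ^ 6) * (qPochInf (-s ^ 3) (-s ^ 6) * qPochInf (s ^ 5) (-s ^ 6)) *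
      qPochInf (s ^ 8) (s ^ 24) = qPochInf (s ^ 12) (s ^ 24) * qPochInf (s ^ 4) (s ^ 4) := by
    calc _ = (qPochInf (s ^ 3) (-s ^ 6) * qPochInf (-s ^ 3) (-s ^ 6)) *
          (qPochInf (s ^ 5) (-s ^ 6) * qPochInf (-s ^ 5) (-s ^ 6)) * qPochInf (-s ^ 6) (-s ^ 6) *
          qPochInf (s ^ 4) (-s ^ 6) * qPochInf (s ^ 8) (s ^ 24) := by ring
      _ = (qPochInf (s ^ 6) (s ^ 12) * qPochInf (-s ^ 6) (s ^ 12)) *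
          (qPochInf (s ^ 10) (s ^ 12) * qPochInf (-s ^ 10) (s ^ 12)) * qPochInf (s ^ 12) (s ^ 12) *
          qPochInf (s ^ 4) (s ^ 12) * qPochInf (s ^ 8) (s ^ 24) := by
        rw [f1, f2, f3, f4]; ring
      _ = _ := by rw [f5, f6, f8, f7]; ring
  rw [twoPhiOne_eq_base_neg_sq hs0 hs hω, e1, e4]
  rw [div_eq_div_iff (by positivity) (by positivity)]
  apply mul_left_cancel₀ n2
  generalize qPochInf (s ^ 2 * ω ^ 2) (s ^ 4) = X at *
  linear_combination (X * qPochInf (-s) (-s ^ 6)) * key + (X * qPochInf (-s) (-s ^ 6) *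
    qPochInf (s ^ 3) (-s ^ 6) * qPochInf (-s ^ 5) (-s ^ 6) *
    qPochInf (s ^ 4) (-s ^ 6) * (qPochInf (-s ^ 3) (-s ^ 6) * qPochInf (s ^ 5) (-s ^ 6)) *
      qPochInf (s ^ 8) (s ^ 24)) * e2 -
    (X * qPochInf (-s) (-s ^ 6) * qPochInf (s ^ 12) (s ^ 24)) * e3

/-! ### The generating function of the triple sum -/

open PowerSeries in
theorem rescale_sq_qExp {q : ℂ} (hq : ‖q‖ < 1) (α : ℂ) : rescale (q ^ 2) (qExp q α) =
    (1 - C (α * q) * X) * (1 - C α * X) * qExp q α := by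
  rw [pow_two, ← rescale_rescale, rescale_qExp hq, map_mul, rescale_qExp hq]
  simp only [map_sub, map_one, map_mul, rescale_X]
  rw [show rescale q (C α) = C α by ext n; cases n <;> simp [coeff_C]]
  ring

open PowerSeries in
/-- The `q`-difference equation of `(αX³; q³)_∞` under `X ↦ qX`. -/
theorem expand_qExpInv_eq {q : ℂ} (hq : ‖q‖ < 1) (α : ℂ) :
    expand 3 three_ne_zero (qExpInv (q ^ 3) α) = (1 - C α * X ^ 3) *
      rescale q (expand 3 three_ne_zero (qExpInv (q ^ 3) α)) := by
  have h : rescale q (expand 3 three_ne_zero (qExpInv (q ^ 3) α)) =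
      expand 3 three_ne_zero (rescale (q ^ 3) (qExpInv (q ^ 3) α)) := by
    ext n
    rw [coeff_rescale]
    by_cases hn : 3 ∣ n
    · obtain ⟨k, rfl⟩ := hn
      rw [coeff_expand_mul, coeff_expand_mul, coeff_rescale, pow_mul]
    · rw [coeff_expand_of_not_dvd _ _ _ hn, coeff_expand_of_not_dvd _ _ _ hn, mul_zero]
  have h' := congrArg (expand 3 three_ne_zero) (qExpInv_eq (norm_pow_lt_one hq three_ne_zero) α)
  rw [map_mul, map_sub, map_one, map_mul, expand_C, expand_X, ← h] at h'
  exact h'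

/-- The series with coefficients `(c;p)_m p^{-m(m-1)/2} z^m h_m` where `h_m` are the coefficients
of `(z;p)_∞ ₂φ₁(a, b; c; p, z)`, for the parameters `a = sω`, `b = -s³ω`, `c = -s⁴`, `p = s⁴`,
`z = s²ω²`. It is the expansion of
`(s⁶ωX, s⁶ω²X; s⁴)_∞ / (-s³X, s⁵X; s⁴)_∞`, a generating function of Al-Salam–Chihara
polynomials. -/
noncomputable def alSalamChiharaSeries (s ω : ℂ) : PowerSeries ℂ :=
  PowerSeries.mk fun m => qPoch (-s ^ 4) (s ^ 4) m * ((s ^ 4) ^ m.choose 2)⁻¹ *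
    (s ^ 2 * ω ^ 2) ^ m * eulerCoeff (s * ω) (-s ^ 3 * ω) (-s ^ 4) (s ^ 4) m

open PowerSeries in
/-- The first-order `q`-difference equation of the Al-Salam–Chihara generating function, with
`(1 - s⁶ωX)(1 - s⁶ω²X) = 1 + s⁶X + s¹²X²`. It expresses the recurrence of `eulerCoeff`. -/
theorem rescale_alSalamChiharaSeries {s ω : ℂ} (hs0 : s ≠ 0) (hs : ‖s‖ < 1)
    (hω : IsPrimitiveRoot ω 3) :
    (1 + C (s ^ 6) * X + C (s ^ 12) * X ^ 2) * rescale (s ^ 4) (alSalamChiharaSeries s ω) =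
      (1 + C (s ^ 3) * X) * (1 - C (s ^ 5) * X) * alSalamChiharaSeries s ω := by
  have h1 := hω.one_add_add_sq
  have h3 := hω.pow_eq_one
  have hp : ‖s ^ 4‖ < 1 := norm_pow_lt_one hs four_ne_zero
  have hp0 : s ^ 4 ≠ 0 := pow_ne_zero _ hs0
  have hc : ‖-s ^ 4‖ < 1 := by rwa [norm_neg]
  have hz1 : s ^ 2 * ω ^ 2 * (s * ω * (-s ^ 3 * ω) + -s ^ 4) = s ^ 6 := by
    linear_combination (-s ^ 6 * ω) * h3 - s ^ 6 * h1
  have hz2 : s ^ 2 * ω ^ 2 * (s * ω + -s ^ 3 * ω) = s ^ 3 - s ^ 5 := by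
    linear_combination (s ^ 3 - s ^ 5) * h3
  have hz3 : s * ω * (-s ^ 3 * ω) * (s ^ 2 * ω ^ 2) ^ 2 = -s ^ 8 := by
    linear_combination (-s ^ 8 * (ω ^ 3 + 1)) * h3
  have hG : ∀ m, coeff m (alSalamChiharaSeries s ω) * (s ^ 4) ^ m.choose 2 =
      qPoch (-s ^ 4) (s ^ 4) m * (s ^ 2 * ω ^ 2) ^ m *
        eulerCoeff (s * ω) (-s ^ 3 * ω) (-s ^ 4) (s ^ 4) m := fun m => by
    have := pow_ne_zero (m.choose 2) hp0
    rw [alSalamChiharaSeries, coeff_mk]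
    field_simp
  have hr1 := eulerCoeff_one (s * ω) (-s ^ 3 * ω) hc hp hp0
  have hr2 := eulerCoeff_add_two (s * ω) (-s ^ 3 * ω) hc hp hp0
  generalize alSalamChiharaSeries s ω = G at *
  rw [show (1 + C (s ^ 6) * X + C (s ^ 12) * X ^ 2) * rescale (s ^ 4) G = rescale (s ^ 4) G +
      X * (C (s ^ 6) * rescale (s ^ 4) G) + X * (X * (C (s ^ 12) * rescale (s ^ 4) G)) by ring,
    show (1 + C (s ^ 3) * X) * (1 - C (s ^ 5) * X) * G = G + X * (C (s ^ 3 - s ^ 5) * G) -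
      X * (X * (C (s ^ 8) * G)) by
        rw [map_sub, show s ^ 8 = s ^ 3 * s ^ 5 by ring, map_mul]; ring]
  ext n
  rcases n with _ | _ | n
  · simp only [map_add, map_sub, coeff_zero_X_mul, coeff_rescale]; ring
  · have g0 := hG 0
    have g1 := hG (0 + 1)
    simp only [map_add, map_sub, sub_mul, coeff_zero_X_mul, coeff_succ_X_mul, coeff_rescale,
      coeff_C_mul]
    simp only [qPoch_succ, eulerCoeff_zero, Nat.choose, qPoch_zero, zero_add, pow_zero, pow_one,
      mul_one, one_mul] at g0 g1 ⊢
    linear_combination (s ^ 6 - s ^ 3 + s ^ 5) * g0 - (1 - s ^ 4) * g1 - s ^ 2 * ω ^ 2 * hr1 -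
      hz1 + hz2
  · have g0 := hG n
    have g1 := hG (n + 1)
    have g2 := hG (n + 1 + 1)
    have hr := hr2 n
    have hP := pow_ne_zero (n.choose 2) hp0
    have hx := pow_ne_zero n hp0
    have hP1 : (s ^ 4) ^ (n + 1).choose 2 = (s ^ 4) ^ n.choose 2 * (s ^ 4) ^ n := by
      rw [Nat.choose_succ_succ' n 1, Nat.choose_one_right, pow_add, mul_comm]
    have hP2 : (s ^ 4) ^ (n + 1 + 1).choose 2 =
        (s ^ 4) ^ n.choose 2 * (s ^ 4) ^ n * ((s ^ 4) ^ n * s ^ 4) := by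
      rw [Nat.choose_succ_succ' (n + 1) 1, Nat.choose_one_right, pow_add, hP1, pow_succ]
      ring
    rw [hP1] at g1
    rw [hP2] at g2
    simp only [map_add, map_sub, sub_mul, coeff_succ_X_mul, coeff_rescale, coeff_C_mul]
    rw [show 2 * n + 2 = n + n + 1 + 1 by ring, show 2 * n + 1 = n + n + 1 by ring] at hr
    rw [qPoch_succ] at g1
    rw [qPoch_succ, qPoch_succ] at g2
    simp only [pow_succ (s ^ 4) (_ + _), pow_succ (s ^ 4) n, pow_add (s ^ 4) n n,
      pow_succ (s ^ 2 * ω ^ 2) (n + 1), pow_succ (s ^ 2 * ω ^ 2) n] at g1 g2 hr ⊢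
    apply mul_left_cancel₀ (mul_ne_zero hP (mul_ne_zero hx (mul_ne_zero hx hp0)))
    generalize (s ^ 4) ^ n.choose 2 = P at *
    generalize (s ^ 4) ^ n = x at *
    generalize (s ^ 2 * ω ^ 2) ^ n = Z at *
    generalize eulerCoeff (s * ω) (-s ^ 3 * ω) (-s ^ 4) (s ^ 4) n = h0 at *
    generalize eulerCoeff (s * ω) (-s ^ 3 * ω) (-s ^ 4) (s ^ 4) (n + 1) = k1 at *
    generalize eulerCoeff (s * ω) (-s ^ 3 * ω) (-s ^ 4) (s ^ 4) (n + 2) = k2 at *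
    generalize qPoch (-s ^ 4) (s ^ 4) n = K at *
    linear_combination (s ^ 8 * x - 1) * g2 +
      (s ^ 10 * x - s ^ 3 + s ^ 5) * x * s ^ 4 * g1 +
      (s ^ 12 * x + s ^ 8) * x ^ 2 * s ^ 4 * g0 -
      K * (1 + s ^ 4 * x) * (s ^ 2 * ω ^ 2) ^ 2 * Z * hr -
      K * (1 + s ^ 4 * x) * (s ^ 2 * ω ^ 2) * Z * k1 * x * s ^ 4 * (s ^ 4 * x * hz1 - hz2) +
      K * (1 + s ^ 4 * x) * Z * h0 * x ^ 2 * s ^ 4 * hz3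

open PowerSeries in
/-- Two expressions for the generating function
`(s¹⁸X³; s¹²)_∞ / ((s⁴X; s²)_∞ (-s³X; -s²)_∞)`. -/
theorem qExp_mul_qExp_mul_expand {s ω : ℂ} (hs0 : s ≠ 0) (hs : ‖s‖ < 1)
    (hω : IsPrimitiveRoot ω 3) :
    qExp (s ^ 2) (s ^ 4) * (qExp (-s ^ 2) (-s ^ 3) *
        expand 3 three_ne_zero (qExpInv (s ^ 12) (s ^ 18))) =
      qExp (s ^ 4) (s ^ 4) * alSalamChiharaSeries s ω := by
  have hs2 : ‖s ^ 2‖ < 1 := norm_pow_lt_one hs two_ne_zero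
  have hs2' : ‖-s ^ 2‖ < 1 := by rwa [norm_neg]
  have hs4 : ‖s ^ 4‖ < 1 := norm_pow_lt_one hs four_ne_zero
  have hU := rescale_sq_qExp hs2 (s ^ 4)
  have hV := rescale_sq_qExp hs2' (-s ^ 3)
  have hW := expand_qExpInv_eq hs4 (s ^ 18)
  have hE := rescale_qExp hs4 (s ^ 4)
  have hG := rescale_alSalamChiharaSeries hs0 hs hω
  rw [show (s ^ 2) ^ 2 = s ^ 4 by ring] at hU
  rw [show (-s ^ 2) ^ 2 = s ^ 4 by ring] at hV
  rw [show (s ^ 4) ^ 3 = s ^ 12 by ring] at hW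
  refine eq_of_rescale_eq (p := s ^ 4) (P := 1 - C (s ^ 18) * X ^ 3)
    (Q := (1 - C (s ^ 6) * X) * (1 - C (s ^ 4) * X) * (1 + C (s ^ 3) * X) * (1 - C (s ^ 5) * X))
    (pow_ne_one_of_norm_lt_one hs4) (by simp) (by simp) ?_ ?_ ?_
  · rw [map_mul, map_mul, hU, hV]
    simp only [map_mul, map_neg, map_pow] at *
    linear_combination - (1 - C s ^ 6 * X) * (1 - C s ^ 4 * X) * (1 + C s ^ 3 * X) *
      (1 - C s ^ 5 * X) * qExp (s ^ 2) (s ^ 4) * qExp (-s ^ 2) (-s ^ 3) * hW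
  · rw [map_mul, hE]
    simp only [map_mul, map_neg, map_pow] at *
    linear_combination (1 - C s ^ 6 * X) * (1 - C s ^ 4 * X) * qExp (s ^ 4) (s ^ 4) * hG
  · simp [qExp, qExpInv, alSalamChiharaSeries, eulerCoeff_zero, coeff_mul]

/-! ### The triple sum -/

open PowerSeries in
theorem tsum_coeff_mul_of_summable_norm {f : ℕ → ℂ} (hf : ∀ n, ‖f n‖ ≤ 1) {φ ψ : ℂ⟦X⟧}
    (hφ : Summable fun n => ‖coeff n φ‖) (hψ : Summable fun n => ‖coeff n ψ‖) :
    (Summable fun x : ℕ × ℕ => f (x.1 + x.2) * (coeff x.1 φ * coeff x.2 ψ)) ∧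
    ∑' n, f n * coeff n (φ * ψ) = ∑' x : ℕ × ℕ, f (x.1 + x.2) * (coeff x.1 φ * coeff x.2 ψ) := by
  have h : Summable fun x : ℕ × ℕ => f (x.1 + x.2) * (coeff x.1 φ * coeff x.2 ψ) :=
    Summable.of_norm_bounded (hφ.mul_norm hψ) fun x => by
      rw [norm_mul]
      exact mul_le_of_le_one_left (norm_nonneg _) (hf _)
  exact ⟨h, tsum_coeff_mul h⟩

open PowerSeries in
/-- Regrouping of a triple sum by the value of `i + j + l`. -/
theorem tsum_coeff_mul_mul {f : ℕ → ℂ} (hf : ∀ n, ‖f n‖ ≤ 1) {φ ψ χ : ℂ⟦X⟧}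
    (hφ : Summable fun n => ‖coeff n φ‖) (hψ : Summable fun n => ‖coeff n ψ‖)
    (hχ : Summable fun n => ‖coeff n χ‖) :
    (Summable fun x : ℕ × ℕ × ℕ =>
      f (x.1 + x.2.1 + x.2.2) * (coeff x.1 φ * (coeff x.2.1 ψ * coeff x.2.2 χ))) ∧
    ∑' x : ℕ × ℕ × ℕ, f (x.1 + x.2.1 + x.2.2) * (coeff x.1 φ * (coeff x.2.1 ψ * coeff x.2.2 χ)) =
      ∑' n, f n * coeff n (φ * (ψ * χ)) := by
  have hs : Summable fun x : ℕ × ℕ × ℕ =>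
      f (x.1 + x.2.1 + x.2.2) * (coeff x.1 φ * (coeff x.2.1 ψ * coeff x.2.2 χ)) :=
    Summable.of_norm_bounded (hφ.mul_norm (hψ.mul_norm hχ)) fun x => by
      rw [norm_mul]
      exact mul_le_of_le_one_left (norm_nonneg _) (hf _)
  have hψχ : Summable fun n => ‖coeff n (ψ * χ)‖ := by
    simpa using (tsum_coeff_mul_mul_pow (z := 1) (by simpa using hψ) (by simpa using hχ)).1
  have h := tsum_coeff_mul_of_summable_norm hf hφ hψχ
  refine ⟨hs, ?_⟩
  rw [h.2, hs.tsum_prod, h.1.tsum_prod]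
  refine tsum_congr fun i => ?_
  have h' := (tsum_coeff_mul_of_summable_norm (f := fun n => f (i + n)) (fun n => hf _) hψ hχ).2
  calc _ = coeff i φ * ∑' x : ℕ × ℕ, f (i + (x.1 + x.2)) * (coeff x.1 ψ * coeff x.2 χ) := by
        rw [← tsum_mul_left]
        exact tsum_congr fun x => by rw [add_assoc]; ring
    _ = _ := by
        rw [← h', ← tsum_mul_left]
        exact tsum_congr fun x => by ring

theorem summable_norm_coeff_qExp {q α : ℂ} (hq : ‖q‖ < 1) (hα : ‖α‖ < 1) :
    Summable fun n => ‖PowerSeries.coeff n (qExp q α)‖ := by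
  refine (summable_norm_qBinomial 0 hq hα).congr fun n => ?_
  rw [qExp, PowerSeries.coeff_mk, qPoch_zero_left, one_div_mul_eq_div]

theorem summable_norm_coeff_qExpInv {q α : ℂ} (hq : ‖q‖ < 1) (hα : ‖α‖ < 1) :
    Summable fun n => ‖PowerSeries.coeff n (qExpInv q α)‖ := by
  refine (summable_norm_qExpInv hq hα).congr fun n => ?_
  rw [qExpInv, qExpInv, PowerSeries.coeff_mk, PowerSeries.coeff_mk, neg_pow α]
  ring_nf

open PowerSeries in
theorem summable_norm_coeff_expand {φ : ℂ⟦X⟧} (hφ : Summable fun n => ‖coeff n φ‖) :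
    Summable fun n => ‖coeff n (expand 3 three_ne_zero φ)‖ := by
  have hinj : Function.Injective fun k : ℕ => 3 * k := fun a b h => by simpa using h
  refine (hinj.summable_iff ?_).1 (hφ.congr fun k => ?_)
  · intro n hn
    rw [coeff_expand_of_not_dvd, norm_zero]
    rintro ⟨k, rfl⟩
    exact hn ⟨k, rfl⟩
  · simp only [Function.comp_apply, coeff_expand_mul]

open PowerSeries in
theorem tripleTerm_eq (s : ℂ) (i j k : ℕ) : tripleTerm (s ^ 2) s i j k =
    (s ^ 4) ^ (i + j + 3 * k).choose 2 * (coeff i (qExp (s ^ 2) (s ^ 4)) *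
      (coeff j (qExp (-s ^ 2) (-s ^ 3)) *
        coeff (3 * k) (expand 3 three_ne_zero (qExpInv (s ^ 12) (s ^ 18))))) := by
  rw [coeff_expand_mul]
  simp only [tripleTerm, qExp, qExpInv, coeff_mk]
  rw [neg_pow (s ^ 3), neg_pow (s ^ 18)]
  simp only [← pow_mul]
  generalize (i + j + 3 * k).choose 2 = N
  generalize k.choose 2 = M
  rw [div_mul_div_comm, div_mul_div_comm, mul_div_assoc']
  congr 1
  · ring
  · ring

/-- A sum over `(i, j, l)` supported on multiples of `3` in `l` is a sum over `(i, j, 3k)`. -/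
theorem tsum_comp_three_mul {F : ℕ × ℕ × ℕ → ℂ} (hF : Summable F)
    (h0 : ∀ i j l, ¬ 3 ∣ l → F (i, j, l) = 0) :
    (Summable fun x : ℕ × ℕ × ℕ => F (x.1, x.2.1, 3 * x.2.2)) ∧
      ∑' x : ℕ × ℕ × ℕ, F (x.1, x.2.1, 3 * x.2.2) = ∑' x, F x := by
  have hinj : Function.Injective fun x : ℕ × ℕ × ℕ => (x.1, x.2.1, 3 * x.2.2) := by
    rintro ⟨i, j, k⟩ ⟨i', j', k'⟩ h
    simpa using h
  refine ⟨hF.comp_injective hinj, hinj.tsum_eq ?_⟩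
  rintro ⟨i, j, l⟩ hx
  by_cases hl : 3 ∣ l
  · obtain ⟨k, rfl⟩ := hl
    exact ⟨(i, j, k), rfl⟩
  · exact absurd (h0 i j l hl) hx

theorem add_choose_two (i m : ℕ) : (i + m).choose 2 = i.choose 2 + m.choose 2 + i * m := by
  induction m with
  | zero => simp
  | succ m ih =>
    rw [← add_assoc, Nat.choose_succ_succ' _ 1, Nat.choose_succ_succ' m 1, ih,
      Nat.choose_one_right, Nat.choose_one_right]
    ring

open PowerSeries in
/-- The triple sum converges, and its sum is that of `p^{n(n-1)/2} c_n`, with `p = s⁴` and `c_n`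
the coefficients of the generating function. -/
theorem tsum_tripleTerm_eq_tsum_coeff {s : ℂ} (hs : ‖s‖ < 1) :
    (Summable fun x : ℕ × ℕ × ℕ => tripleTerm (s ^ 2) s x.1 x.2.1 x.2.2) ∧
    ∑' x : ℕ × ℕ × ℕ, tripleTerm (s ^ 2) s x.1 x.2.1 x.2.2 =
      ∑' n : ℕ, (s ^ 4) ^ n.choose 2 * coeff n (qExp (s ^ 2) (s ^ 4) * (qExp (-s ^ 2) (-s ^ 3) *
        expand 3 three_ne_zero (qExpInv (s ^ 12) (s ^ 18)))) := by
  have hp : ∀ n : ℕ, n ≠ 0 → ‖s ^ n‖ < 1 := fun n hn => norm_pow_lt_one hs hn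
  have hpn : ∀ n : ℕ, n ≠ 0 → ‖-s ^ n‖ < 1 := fun n hn => by rw [norm_neg]; exact hp n hn
  have h := tsum_coeff_mul_mul (f := fun n => (s ^ 4) ^ n.choose 2)
    (fun n => by rw [norm_pow]; exact pow_le_one₀ (norm_nonneg _) (hp 4 (by norm_num)).le)
    (summable_norm_coeff_qExp (hp 2 (by norm_num)) (hp 4 (by norm_num)))
    (summable_norm_coeff_qExp (hpn 2 (by norm_num)) (hpn 3 (by norm_num)))
    (summable_norm_coeff_expand
      (summable_norm_coeff_qExpInv (hp 12 (by norm_num)) (hp 18 (by norm_num))))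
  have h' := tsum_comp_three_mul h.1 fun i j l hl => by
    simp only [coeff_expand_of_not_dvd _ _ _ hl, mul_zero]
  simp only [tripleTerm_eq]
  exact ⟨h'.1, h'.2.trans h.2⟩

open PowerSeries in
/-- The relation between the triple sum and the `₂φ₁` series. -/
theorem tsum_tripleTerm_eq_twoPhiOne {s ω : ℂ} (hs0 : s ≠ 0) (hs : ‖s‖ < 1)
    (hω : IsPrimitiveRoot ω 3) :
    ∑' x : ℕ × ℕ × ℕ, tripleTerm (s ^ 2) s x.1 x.2.1 x.2.2 =
      qPochInf (-s ^ 4) (s ^ 4) * qPochInf (s ^ 2 * ω ^ 2) (s ^ 4) *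
        twoPhiOne (s * ω) (-s ^ 3 * ω) (-s ^ 4) (s ^ 4) (s ^ 2 * ω ^ 2) := by
  have hp : ‖s ^ 4‖ < 1 := norm_pow_lt_one hs four_ne_zero
  have hp0 : s ^ 4 ≠ 0 := pow_ne_zero _ hs0
  have hc : ‖-s ^ 4‖ < 1 := by rwa [norm_neg]
  have hz : ‖s ^ 2 * ω ^ 2‖ < 1 := by
    rw [norm_mul, norm_pow ω, norm_primitiveRoot_three hω, one_pow, mul_one]
    exact norm_pow_lt_one hs two_ne_zero
  have hH := tsum_eulerCoeff (s * ω) (-s ^ 3 * ω) hc hp hz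
  rw [(tsum_tripleTerm_eq_tsum_coeff hs).2, qExp_mul_qExp_mul_expand hs0 hs hω, mul_assoc, ← hH.2]
  obtain ⟨h, hh⟩ : ∃ h : ℕ → ℂ, h = eulerCoeff (s * ω) (-s ^ 3 * ω) (-s ^ 4) (s ^ 4) := ⟨_, rfl⟩
  rw [← hh] at hH ⊢
  -- `p^{(i+m)(i+m-1)/2} = p^{i(i-1)/2} p^{m(m-1)/2} p^{im}` splits off the sum over `i`
  have hsplit : ∀ i m : ℕ, (s ^ 4) ^ (i + m).choose 2 * (coeff i (qExp (s ^ 4) (s ^ 4)) *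
      coeff m (alSalamChiharaSeries s ω)) = (s ^ 2 * ω ^ 2) ^ m * h m * (qPoch (-s ^ 4) (s ^ 4) m *
        (coeff i (qExpInv (s ^ 4) 1) * (-s ^ 4 * (s ^ 4) ^ m) ^ i)) := fun i m => by
    have e : (-s ^ 4 * (s ^ 4) ^ m) ^ i = (-1) ^ i * ((s ^ 4) ^ i * (s ^ 4) ^ (i * m)) := by
      rw [neg_mul, neg_pow, mul_pow, ← pow_mul (s ^ 4) m, mul_comm m i]
    rw [alSalamChiharaSeries, qExp, qExpInv, coeff_mk, coeff_mk, coeff_mk, ← hh,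
      add_choose_two, pow_add, pow_add, e]
    have h1 := qPoch_ne_zero hp hp i
    have h2 := pow_ne_zero (m.choose 2) hp0
    have h3 : (-1 : ℂ) ^ i * (-1) ^ i = 1 := by rw [← mul_pow]; simp
    generalize (s ^ 2 * ω ^ 2) ^ m = Z
    generalize (-1 : ℂ) ^ i = ε at *
    field_simp
    linear_combination (-(qPoch (-s ^ 4) (s ^ 4) m * Z * h m)) * h3
  have hsum : Summable fun x : ℕ × ℕ => (s ^ 4) ^ (x.1 + x.2).choose 2 *
      (coeff x.1 (qExp (s ^ 4) (s ^ 4)) * coeff x.2 (alSalamChiharaSeries s ω)) := by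
    obtain ⟨K, hK⟩ := exists_norm_qPoch_le (-s ^ 4) hp
    have hK0 := (norm_nonneg _).trans (hK 0)
    refine Summable.of_norm_bounded
      (((summable_norm_qExpInv hp hc).mul_norm hH.1).mul_left K) fun x => ?_
    rw [hsplit, norm_mul, norm_mul (qPoch _ _ _), norm_mul _ (h _ * _), mul_comm (_ ^ _) (h _)]
    have : ‖coeff x.1 (qExpInv (s ^ 4) 1) * (-s ^ 4 * (s ^ 4) ^ x.2) ^ x.1‖ ≤
        ‖coeff x.1 (qExpInv (s ^ 4) 1) * (-s ^ 4) ^ x.1‖ := by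
      rw [norm_mul, norm_mul, norm_pow, norm_pow, norm_mul]
      gcongr
      refine mul_le_of_le_one_right (norm_nonneg _) ?_
      rw [norm_pow]
      exact pow_le_one₀ (norm_nonneg _) hp.le
    calc _ ≤ ‖h x.2 * (s ^ 2 * ω ^ 2) ^ x.2‖ *
          (K * ‖coeff x.1 (qExpInv (s ^ 4) 1) * (-s ^ 4) ^ x.1‖) := by
          gcongr
          exact hK _
      _ = _ := by ring
  rw [tsum_coeff_mul (f := fun n => (s ^ 4) ^ n.choose 2) hsum, ← tsum_mul_left]
  rw [← (Equiv.prodComm ℕ ℕ).summable_iff] at hsum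
  rw [← (Equiv.prodComm ℕ ℕ).tsum_eq]
  refine hsum.tsum_prod.trans (tsum_congr fun m => ?_)
  simp only [Function.comp_apply, Equiv.prodComm_apply, Prod.swap_prod_mk, hsplit]
  rw [tsum_mul_left, tsum_mul_left, tsum_qExpInv hp (norm_mul_pow_lt_one hc hp m),
    ← qPochInf_eq_qPoch_mul _ hp]
  ring

/-! ### Evaluation of the triple sum -/

/-- The products that remain once the common factors of the two evaluations are removed. They agree
because `(-x; x)_∞ (x; x²)_∞ = 1`, here with `x = q²`. -/
theorem qPochInf_mul_eq_one_div {q : ℂ} (hq : ‖q‖ < 1) :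
    qPochInf (-q ^ 2) (q ^ 2) * qPochInf (q ^ 6) (q ^ 12) / qPochInf (q ^ 4) (q ^ 12) =
      1 / (qPochInf (q ^ 4) (q ^ 6) * qPochInf (q ^ 2) (q ^ 12)) := by
  have hp : ∀ n : ℕ, n ≠ 0 → ‖q ^ n‖ < 1 := fun n hn => norm_pow_lt_one hq hn
  have e1 : qPochInf (q ^ 2) (q ^ 2) * qPochInf (-q ^ 2) (q ^ 2) = qPochInf (q ^ 4) (q ^ 4) := by
    rw [qPochInf_mul_qPochInf_neg _ (hp 2 (by norm_num))]; ring_nf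
  have e2 : qPochInf (q ^ 2) (q ^ 2) = qPochInf (q ^ 2) (q ^ 4) * qPochInf (q ^ 4) (q ^ 4) := by
    rw [qPochInf_sq_base _ (hp 2 (by norm_num))]; ring_nf
  have e3 : qPochInf (q ^ 2) (q ^ 4) =
      qPochInf (q ^ 2) (q ^ 12) * qPochInf (q ^ 6) (q ^ 12) * qPochInf (q ^ 10) (q ^ 12) := by
    rw [qPochInf_cube_base _ (hp 4 (by norm_num))]; ring_nf
  have e4 : qPochInf (q ^ 4) (q ^ 6) = qPochInf (q ^ 4) (q ^ 12) * qPochInf (q ^ 10) (q ^ 12) := by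
    rw [qPochInf_sq_base _ (hp 6 (by norm_num))]; ring_nf
  have n0 : ∀ m n : ℕ, m ≠ 0 → n ≠ 0 → qPochInf (q ^ m) (q ^ n) ≠ 0 := fun m n hm hn =>
    qPochInf_ne_zero (hp m hm) (hp n hn)
  have n1 := n0 4 4 (by norm_num) (by norm_num)
  have n2 := n0 4 12 (by norm_num) (by norm_num)
  have n3 := n0 10 12 (by norm_num) (by norm_num)
  have n4 := n0 2 12 (by norm_num) (by norm_num)
  have e5 : qPochInf (q ^ 2) (q ^ 4) * qPochInf (-q ^ 2) (q ^ 2) = 1 := by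
    apply mul_left_cancel₀ n1
    rw [e2] at e1
    linear_combination e1
  rw [e4, div_eq_div_iff n2 (mul_ne_zero (mul_ne_zero n2 n3) n4)]
  rw [e3] at e5
  linear_combination qPochInf (q ^ 4) (q ^ 12) * e5

theorem mainTheorem3 (q ω : ℂ) (hq0 : 0 < ‖q‖) (hq1 : ‖q‖ < 1) (hω : IsPrimitiveRoot ω 3) :
    -- the triple sum, for every choice `s` of `q^{1/2}`
    (∀ s : ℂ, s ^ 2 = q →
      HasSum (fun x : ℕ × ℕ × ℕ => tripleTerm q s x.1 x.2.1 x.2.2)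
        (1 / (qPochInf (-s ^ 3) (-q ^ 3) * qPochInf (s ^ 5) (-q ^ 3) *
          qPochInf (q ^ 4) (q ^ 6) * qPochInf (q ^ 2) (q ^ 12)))) ∧
    -- the summation of `₂φ₁`, for every choice `r` of `q^{1/4}`
    (∀ r : ℂ, r ^ 4 = q →
      HasSum (twoPhiOneTerm (r * ω) (-r ^ 3 * ω) (-q) q (r ^ 2 * ω ^ 2))
        (qPochInf (q ^ 3) (q ^ 6) /
          (qPochInf (r ^ 2 * ω ^ 2) q *
            (qPochInf (-r ^ 3) (-r ^ 6) * qPochInf (r ^ 5) (-r ^ 6)) *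
            qPochInf (q ^ 2) (q ^ 6)))) ∧
    -- the relation between the two series, through which the two formulas are equivalent
    (∀ s : ℂ, s ^ 2 = q →
      Summable (twoPhiOneTerm (s * ω) (-s ^ 3 * ω) (-q ^ 2) (q ^ 2) (q * ω ^ 2)) ∧
      ∑' x : ℕ × ℕ × ℕ, tripleTerm q s x.1 x.2.1 x.2.2 =
        qPochInf (-q ^ 2) (q ^ 2) * qPochInf (q * ω ^ 2) (q ^ 2) *
          twoPhiOne (s * ω) (-s ^ 3 * ω) (-q ^ 2) (q ^ 2) (q * ω ^ 2)) := by
  have hroot : ∀ (s : ℂ) (n : ℕ), n ≠ 0 → s ^ n = q → s ≠ 0 ∧ ‖s‖ < 1 := by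
    rintro s n hn rfl
    refine ⟨?_, ?_⟩
    · rintro rfl
      simp [hn] at hq0
    · rw [norm_pow] at hq1
      exact (pow_lt_one_iff_of_nonneg (norm_nonneg _) hn).1 hq1
  have hsum : ∀ s : ℂ, ‖s‖ < 1 →
      Summable (twoPhiOneTerm (s * ω) (-s ^ 3 * ω) (-s ^ 4) (s ^ 4) (s ^ 2 * ω ^ 2)) := by
    intro s hs
    have h4 : ‖s ^ 4‖ < 1 := norm_pow_lt_one hs four_ne_zero
    refine (summable_norm_twoPhiOneTerm _ _ (by rwa [norm_neg]) h4 ?_).of_norm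
    rw [norm_mul, norm_pow ω, norm_primitiveRoot_three hω, one_pow, mul_one]
    exact norm_pow_lt_one hs two_ne_zero
  refine ⟨?_, ?_, ?_⟩
  · rintro s hsq
    obtain ⟨hs0, hs⟩ := hroot s 2 two_ne_zero hsq
    have h := (tsum_tripleTerm_eq_tsum_coeff hs).1.hasSum
    have hp := qPochInf_mul_eq_one_div hq1
    rw [tsum_tripleTerm_eq_twoPhiOne hs0 hs hω, twoPhiOne_eq hs0 hs hω, hsq] at h
    convert h using 1
    subst hsq
    have n1 : qPochInf (s ^ 2 * ω ^ 2) (s ^ 4) ≠ 0 := by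
      refine qPochInf_ne_zero ?_ (norm_pow_lt_one hs four_ne_zero)
      rw [norm_mul, norm_pow ω, norm_primitiveRoot_three hω, one_pow, mul_one]
      exact hq1
    simp only [← pow_mul, Nat.reduceMul] at hp ⊢
    calc _ = 1 / (qPochInf (-s ^ 3) (-s ^ 6) * qPochInf (s ^ 5) (-s ^ 6)) *
          (1 / (qPochInf (s ^ 8) (s ^ 12) * qPochInf (s ^ 4) (s ^ 24))) := by
          rw [one_div_mul_one_div, mul_assoc (_ * _)]
      _ = _ := by
          rw [← hp]
          field_simp
  · rintro r rfl
    obtain ⟨hr0, hr⟩ := hroot r 4 four_ne_zero rfl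
    have h := (hsum r hr).hasSum
    rw [← twoPhiOne, twoPhiOne_eq hr0 hr hω] at h
    simpa only [← pow_mul, Nat.reduceMul] using h
  · rintro s rfl
    obtain ⟨hs0, hs⟩ := hroot s 2 two_ne_zero rfl
    have e : (s ^ 2) ^ 2 = s ^ 4 := by ring
    rw [e]
    exact ⟨hsum s hs, tsum_tripleTerm_eq_twoPhiOne hs0 hs hω⟩
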